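/- Consider the two 3-dimensional non-abelian complex-parallelizable solvable (simply connected) complex Lie groups: (I) the Iwasawa group, i.e. the complex Heisenberg group $\mathbb{C}^3$ with product $z\cdot w=(z_1+w_1,\;z_2+w_2,\;z_3+w_3+z_1w_2)$; and (II) the group $\mathbb{C}\ltimes\mathbb{C}^2$, i.e. $\mathbb{C}^3$ with product $z\cdot w=(z_1+w_1,\;z_2+e^{-z_1}w_2,\;z_3+e^{z_1}w_3)$. Then the group $G$ has a basis $\varphi^1,\varphi^2,\varphi^3$ of left-invariant holomorphic 1-forms satisfying, respectively, $$\text{(I)}\quad d\varphi^1=d\varphi^2=0,\ d\varphi^3=\varphi^{12};\qquad \text{(II)}\quad d\varphi^1=0,\ d\varphi^2=\varphi^{12},\ d\varphi^3=-\varphi^{13},$$ where $\varphi^{ij}=\varphi^i\wedge\varphi^j$. Moreover, writing $\varphi^1=e^1+ie^2$, $\varphi^2=e^3+ie^4$, $\varphi^3=e^5+ie^6$ with real forms $e^k$, the metric $g=\sum_{k=1}^6 e^k\otimes e^k$ is a Hermitian metric on $G$ which is balanced, i.e. its Kähler form $F(X,Y)=g(JX,Y)$ satisfies $d(F\wedge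 F)=0$. Its Bismut connection $\nabla^B$, the connection with $$g(\nabla^B_XY,Z)=g(\nabla^{LC}_XY,Z)+\tfrac12\,T(X,Y,Z),\qquad T(X,Y,Z)=dF(JX,JY,JZ),$$ where $\nabla^{LC}$ is the Levi-Civita connection of $g$, has holonomy equal to $SU(3)$: for every $p\in G$ the group of parallel transports of $\nabla^B$ along piecewise smooth loops based at $p$ is exactly the group of those endomorphisms of $T_pG$ that act in the unitary frame dual to $\varphi^1,\varphi^2,\varphi^3$ by the matrices of $SU(3)$. -/

import Mathlib

open scoped ContDiff Manifold

noncomputable section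

namespace BismutHolonomy

/-! ### Hermitian geometry in a global holomorphic chart

A complex manifold biholomorphic to a complex vector space `E` is identified with `E`.
The tangent space at each point is `E`, the complex structure `J` is multiplication by `I`,
and tensor fields are functions on `E`. -/

section Geometry

variable {E : Type*} [NormedAddCommGroup E] [NormedSpace ℂ E]

/-- A Hermitian metric: a smooth Riemannian metric `g` with `g(Ju, Jv) = g(u, v)`. -/
structure HermitianMetric (E : Type*) [NormedAddCommGroup E] [NormedSpace ℂ E] where
  /-- The bilinear form `g x` on the tangent space at `x`. -/
  toFun : E → E →L[ℝ] E →L[ℝ] ℝ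
  smooth : ContDiff ℝ ∞ toFun
  symm : ∀ x u v, toFun x u v = toFun x v u
  pos : ∀ x u, u ≠ 0 → 0 < toFun x u u
  map_J : ∀ x u v, toFun x (Complex.I • u) (Complex.I • v) = toFun x u v

namespace HermitianMetric

variable (g : HermitianMetric E)

theorem apply_J_self (x v : E) : g.toFun x (Complex.I • v) v = 0 := by
  have h := g.map_J x (Complex.I • v) v
  rw [smul_smul, Complex.I_mul_I, neg_one_smul, map_neg, neg_apply,
    g.symm x v] at h
  linarith

/-- The Kähler form `F(u, v) = g(Ju, v)`. -/
def kahlerForm (x : E) : E [⋀^Fin 2]→L[ℝ] ℝ where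
  toFun v := g.toFun x (Complex.I • v 0) (v 1)
  map_update_add' := by
    intro _ m i a b
    fin_cases i <;> simp [Function.update]
  map_update_smul' := by
    intro _ m i c a
    fin_cases i <;> simp [Function.update, smul_comm Complex.I c a]
  cont := by fun_prop
  map_eq_zero_of_eq' := by
    intro v i j h hij
    have h01 : v 0 = v 1 := by
      fin_cases i <;> fin_cases j <;> simp_all
    change g.toFun x (Complex.I • v 0) (v 1) = 0
    rw [h01]
    exact g.apply_J_self x (v 1)

/-- The torsion form `T = J dF`, that is `T(u, v, w) = dF(Ju, Jv, Jw)`. -/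
def bismutTorsion (x u v w : E) : ℝ :=
  extDeriv g.kahlerForm x ![Complex.I • u, Complex.I • v, Complex.I • w]

/-- The wedge square `β ∧ β` of a real alternating 2-form `β`: the alternatization of
`v ↦ β(v₀, v₁) β(v₂, v₃)`, divided by `2! 2!`. -/
def wedgeSq (β : E [⋀^Fin 2]→L[ℝ] ℝ) : E [⋀^Fin 4]→L[ℝ] ℝ :=
  (1 / 4 : ℝ) • ContinuousMultilinearMap.alternatization
    { toFun := fun v : Fin 4 → E => β ![v 0, v 1] * β ![v 2, v 3]
      map_update_add' := by
        intro inst m i a b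
        obtain rfl : inst = instDecidableEqFin 4 := Subsingleton.elim _ _
        have u0 : ∀ x y z : E, Function.update ![x, y] 0 z = ![z, y] := fun x y z => by
          funext i; fin_cases i <;> rfl
        have u1 : ∀ x y z : E, Function.update ![x, y] 1 z = ![x, z] := fun x y z => by
          funext i; fin_cases i <;> rfl
        have h0 : ∀ p q r : E, β ![p + q, r] = β ![p, r] + β ![q, r] := fun p q r => by
          simpa only [u0, u1, smul_eq_mul] using β.map_update_add ![p, r] 0 p q
        have h1 : ∀ p q r : E, β ![r, p + q] = β ![r, p] + β ![r, q] := fun p q r => by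
          simpa only [u0, u1, smul_eq_mul] using β.map_update_add ![r, p] 1 p q
        fin_cases i <;> simp [Function.update, h0, h1, add_mul, mul_add]
      map_update_smul' := by
        intro inst m i c a
        obtain rfl : inst = instDecidableEqFin 4 := Subsingleton.elim _ _
        have u0 : ∀ x y z : E, Function.update ![x, y] 0 z = ![z, y] := fun x y z => by
          funext i; fin_cases i <;> rfl
        have u1 : ∀ x y z : E, Function.update ![x, y] 1 z = ![x, z] := fun x y z => by
          funext i; fin_cases i <;> rfl
        have h0 : ∀ p q : E, β ![c • p, q] = c * β ![p, q] := fun p q => by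
          simpa only [u0, u1, smul_eq_mul] using β.map_update_smul ![p, q] 0 c p
        have h1 : ∀ p q : E, β ![q, c • p] = c * β ![q, p] := fun p q => by
          simpa only [u0, u1, smul_eq_mul] using β.map_update_smul ![q, p] 1 c p
        fin_cases i <;> simp [Function.update, h0, h1, mul_assoc, mul_left_comm]
      cont := by fun_prop }

/-- A Hermitian metric in complex dimension three is balanced if `d(F ∧ F) = 0`. -/
def IsBalanced : Prop :=
  ∀ x, extDeriv (fun y => wedgeSq (g.kahlerForm y)) x = 0

end HermitianMetric

/-- An affine connection on `E`, given by its Christoffel symbol in the global chart: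
`∇_X Y = DY(X) + Γ(X, Y)`. -/
abbrev Connection (E : Type*) [NormedAddCommGroup E] [NormedSpace ℝ E] :=
  E → E →L[ℝ] E →L[ℝ] E

/-- `Γ` is the Levi-Civita connection of `g`: it is torsion free and metric. -/
def IsLeviCivita (g : HermitianMetric E) (Γ : Connection E) : Prop :=
  (∀ x u v, Γ x u v = Γ x v u) ∧
  ∀ x u v w, fderiv ℝ g.toFun x u v w = g.toFun x (Γ x u v) w + g.toFun x v (Γ x u w)

/-- `Γ` is the Bismut connection of `g`:
`g(∇_X Y, Z) = g(∇^{LC}_X Y, Z) + (1/2) T(X, Y, Z)`. -/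
def IsBismut (g : HermitianMetric E) (Γ : Connection E) : Prop :=
  ∃ Γ₀ : Connection E, IsLeviCivita g Γ₀ ∧
    ∀ x u v w, g.toFun x (Γ x u v) w
      = g.toFun x (Γ₀ x u v) w + (1 / 2) * g.bismutTorsion x u v w

end Geometry

section Holonomy

variable {E : Type*} [NormedAddCommGroup E] [NormedSpace ℝ E]

/-- `V` is a parallel vector field along the curve `γ : [0, 1] → E`:
`V' + Γ(γ', V) = 0`. -/
def IsParallelAlong (Γ : Connection E) (γ V : ℝ → E) : Prop :=
  ∀ t ∈ Set.Icc (0 : ℝ) 1,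
    HasDerivWithinAt V (-(Γ (γ t) (derivWithin γ (Set.Icc 0 1) t) (V t))) (Set.Icc 0 1) t

/-- `IsTransport Γ x y A`: the linear map `A` from the tangent space at `x` to the tangent space
at `y` is the parallel transport along some piecewise smooth curve from `x` to `y`, that is,
along a finite concatenation of smooth curves. -/
inductive IsTransport (Γ : Connection E) : E → E → (E →L[ℝ] E) → Prop
  | smooth (γ : ℝ → E) (hγ : ContDiffOn ℝ ∞ γ (Set.Icc 0 1)) (A : E →L[ℝ] E)
      (hA : ∀ v, ∃ V : ℝ → E, IsParallelAlong Γ γ V ∧ V 0 = v ∧ V 1 = A v) :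
      IsTransport Γ (γ 0) (γ 1) A
  | concat {x y z : E} {A B : E →L[ℝ] E} (hA : IsTransport Γ x y A) (hB : IsTransport Γ y z B) :
      IsTransport Γ x z (B.comp A)

/-- The holonomy group at `p`: parallel transports along piecewise smooth loops based at `p`. -/
def holonomyGroup (Γ : Connection E) (p : E) : Set (E →L[ℝ] E) :=
  {A | IsTransport Γ p p A}

end Holonomy

/-! ### Left-invariant coframes -/

section LeftInvariant

variable {G : Type*} [NormedAddCommGroup G] [NormedSpace ℂ G]

/-- A complex-valued form of type `(1, 0)` as a differential 1-form on the underlying real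
manifold. -/
def oneForm (α : G → G →L[ℂ] ℂ) (x : G) : G [⋀^Fin 1]→L[ℝ] ℂ :=
  ContinuousAlternatingMap.ofSubsingleton ℝ G ℂ 0 ((α x).restrictScalars ℝ)

/-- The form `φ^{ij} = φ^i ∧ φ^j`. -/
def wedge (α β : G → G →L[ℂ] ℂ) (x u v : G) : ℂ :=
  α x u * β x v - α x v * β x u

/-- `φ` is a basis of left-invariant holomorphic 1-forms on a 3-dimensional complex Lie group. -/
structure IsLeftInvariantCoframe [Group G] (φ : Fin 3 → G → G →L[ℂ] ℂ) : Prop where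
  holomorphic : ∀ i, Differentiable ℂ (φ i)
  left_invariant : ∀ i (a x v : G), φ i (a * x) (fderiv ℂ (fun y => a * y) x v) = φ i x v
  bijective : ∀ x, Function.Bijective fun (v : G) (i : Fin 3) => φ i x v

/-- The structure equations `dφ¹ = dφ² = 0`, `dφ³ = φ¹²`. -/
def StructureEquationsI (φ : Fin 3 → G → G →L[ℂ] ℂ) : Prop :=
  ∀ x u v,
    extDeriv (oneForm (φ 0)) x ![u, v] = 0 ∧
    extDeriv (oneForm (φ 1)) x ![u, v] = 0 ∧
    extDeriv (oneForm (φ 2)) x ![u, v] = wedge (φ 0) (φ 1) x u v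

/-- The structure equations `dφ¹ = 0`, `dφ² = φ¹²`, `dφ³ = -φ¹³`. -/
def StructureEquationsII (φ : Fin 3 → G → G →L[ℂ] ℂ) : Prop :=
  ∀ x u v,
    extDeriv (oneForm (φ 0)) x ![u, v] = 0 ∧
    extDeriv (oneForm (φ 1)) x ![u, v] = wedge (φ 0) (φ 1) x u v ∧
    extDeriv (oneForm (φ 2)) x ![u, v] = -wedge (φ 0) (φ 2) x u v

/-- The coframe `φ` is unitary for `g`: with `φ¹ = e¹ + i e²`, `φ² = e³ + i e⁴`,
`φ³ = e⁵ + i e⁶` one has `g = ∑ eᵏ ⊗ eᵏ`. -/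
def IsUnitaryCoframe (g : HermitianMetric G) (φ : Fin 3 → G → G →L[ℂ] ℂ) : Prop :=
  ∀ x u v, g.toFun x u v =
    ∑ i, ((φ i x u).re * (φ i x v).re + (φ i x u).im * (φ i x v).im)

/-- The group `SU(3)` acting on the tangent space at `p` through the frame dual to `φ`. -/
def specialUnitary (φ : Fin 3 → G → G →L[ℂ] ℂ) (p : G) : Set (G →L[ℝ] G) :=
  {A | ∃ U ∈ Matrix.specialUnitaryGroup (Fin 3) ℂ,
    ∀ v, (fun i => φ i p (A v)) = U.mulVec fun i => φ i p v}

end LeftInvariant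

/-! ### The two groups -/

/-- The underlying manifold of the complex Heisenberg group is `ℂ³`. -/
def IwasawaGroup : Type := Fin 3 → ℂ

namespace IwasawaGroup

instance : NormedAddCommGroup IwasawaGroup := inferInstanceAs (NormedAddCommGroup (Fin 3 → ℂ))
instance : NormedSpace ℂ IwasawaGroup := inferInstanceAs (NormedSpace ℂ (Fin 3 → ℂ))

/-- The complex Heisenberg group: `z` stands for the unipotent upper triangular 3 by 3 matrix
with entries `z₀, z₁` above the diagonal and `z₂` in the corner. -/
instance : Group IwasawaGroup where
  mul z w := (![z 0 + w 0, z 1 + w 1, z 2 + w 2 + z 0 * w 1] : Fin 3 → ℂ)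
  one := (![0, 0, 0] : Fin 3 → ℂ)
  inv z := (![-z 0, -z 1, -z 2 + z 0 * z 1] : Fin 3 → ℂ)
  mul_assoc a b c := by
    funext i
    fin_cases i
    · exact add_assoc (a 0) (b 0) (c 0)
    · exact add_assoc (a 1) (b 1) (c 1)
    · change a 2 + b 2 + a 0 * b 1 + c 2 + (a 0 + b 0) * c 1
        = a 2 + (b 2 + c 2 + b 0 * c 1) + a 0 * (b 1 + c 1)
      ring
  one_mul a := by
    funext i
    fin_cases i
    · exact zero_add (a 0)
    · exact zero_add (a 1)
    · change 0 + a 2 + 0 * a 1 = a 2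
      ring
  mul_one a := by
    funext i
    fin_cases i
    · exact add_zero (a 0)
    · exact add_zero (a 1)
    · change a 2 + 0 + a 0 * 0 = a 2
      ring
  inv_mul_cancel a := by
    funext i
    fin_cases i
    · exact neg_add_cancel (a 0)
    · exact neg_add_cancel (a 1)
    · change -a 2 + a 0 * a 1 + a 2 + -a 0 * a 1 = 0
      ring

instance : LieGroup 𝓘(ℂ, IwasawaGroup) ω IwasawaGroup where
  contMDiff_mul := by
    rw [← modelWithCornersSelf_prod]
    rw [chartedSpaceSelf_prod, contMDiff_iff_contDiff]
    have h (i : Fin 3) : ContDiff ℂ ω fun p : IwasawaGroup × IwasawaGroup => p.1 i :=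
      (contDiff_apply ℂ ℂ i).comp (contDiff_fst (E := Fin 3 → ℂ) (F := Fin 3 → ℂ))
    have h' (i : Fin 3) : ContDiff ℂ ω fun p : IwasawaGroup × IwasawaGroup => p.2 i :=
      (contDiff_apply ℂ ℂ i).comp (contDiff_snd (E := Fin 3 → ℂ) (F := Fin 3 → ℂ))
    refine contDiff_pi (E := IwasawaGroup × IwasawaGroup) (F' := fun _ : Fin 3 => ℂ)
      |>.2 fun i => ?_
    fin_cases i
    · exact (h 0).add (h' 0)
    · exact (h 1).add (h' 1)
    · exact ((h 2).add (h' 2)).add ((h 0).mul (h' 1))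
  contMDiff_inv := by
    rw [contMDiff_iff_contDiff]
    have h (i : Fin 3) : ContDiff ℂ ω fun p : IwasawaGroup => p i := contDiff_apply ℂ ℂ i
    refine contDiff_pi (E := IwasawaGroup) (F' := fun _ : Fin 3 => ℂ) |>.2 fun i => ?_
    fin_cases i
    · exact (h 0).neg
    · exact (h 1).neg
    · exact (h 2).neg.add ((h 0).mul (h 1))

end IwasawaGroup

/-- The underlying manifold of the second group is `ℂ³`. -/
def SolvGroup : Type := Fin 3 → ℂ

namespace SolvGroup

instance : NormedAddCommGroup SolvGroup := inferInstanceAs (NormedAddCommGroup (Fin 3 → ℂ))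
instance : NormedSpace ℂ SolvGroup := inferInstanceAs (NormedSpace ℂ (Fin 3 → ℂ))

/-- The semidirect product `ℂ ⋉ ℂ²`, where `z` in `ℂ` acts on `ℂ²` by
`diag(exp (-z), exp z)`. -/
instance : Group SolvGroup where
  mul z w := (![z 0 + w 0, z 1 + Complex.exp (-z 0) * w 1, z 2 + Complex.exp (z 0) * w 2] :
    Fin 3 → ℂ)
  one := (![0, 0, 0] : Fin 3 → ℂ)
  inv z := (![-z 0, -(Complex.exp (z 0) * z 1), -(Complex.exp (-z 0) * z 2)] : Fin 3 → ℂ)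
  mul_assoc a b c := by
    funext i
    fin_cases i
    · exact add_assoc (a 0) (b 0) (c 0)
    · change a 1 + Complex.exp (-a 0) * b 1 + Complex.exp (-(a 0 + b 0)) * c 1
        = a 1 + Complex.exp (-a 0) * (b 1 + Complex.exp (-b 0) * c 1)
      rw [neg_add, Complex.exp_add]
      ring
    · change a 2 + Complex.exp (a 0) * b 2 + Complex.exp (a 0 + b 0) * c 2
        = a 2 + Complex.exp (a 0) * (b 2 + Complex.exp (b 0) * c 2)
      rw [Complex.exp_add]
      ring
  one_mul a := by
    funext i
    fin_cases i
    · exact zero_add (a 0)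
    · change 0 + Complex.exp (-0) * a 1 = a 1
      simp
    · change 0 + Complex.exp 0 * a 2 = a 2
      simp
  mul_one a := by
    funext i
    fin_cases i
    · exact add_zero (a 0)
    · change a 1 + Complex.exp (-a 0) * 0 = a 1
      simp
    · change a 2 + Complex.exp (a 0) * 0 = a 2
      simp
  inv_mul_cancel a := by
    funext i
    fin_cases i
    · exact neg_add_cancel (a 0)
    · change -(Complex.exp (a 0) * a 1) + Complex.exp (- -a 0) * a 1 = 0
      simp
    · change -(Complex.exp (-a 0) * a 2) + Complex.exp (-a 0) * a 2 = 0
      simp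

instance : LieGroup 𝓘(ℂ, SolvGroup) ω SolvGroup where
  contMDiff_mul := by
    rw [← modelWithCornersSelf_prod]
    rw [chartedSpaceSelf_prod, contMDiff_iff_contDiff]
    have h (i : Fin 3) : ContDiff ℂ ω fun p : SolvGroup × SolvGroup => p.1 i :=
      (contDiff_apply ℂ ℂ i).comp (contDiff_fst (E := Fin 3 → ℂ) (F := Fin 3 → ℂ))
    have h' (i : Fin 3) : ContDiff ℂ ω fun p : SolvGroup × SolvGroup => p.2 i :=
      (contDiff_apply ℂ ℂ i).comp (contDiff_snd (E := Fin 3 → ℂ) (F := Fin 3 → ℂ))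
    refine contDiff_pi (E := SolvGroup × SolvGroup) (F' := fun _ : Fin 3 => ℂ)
      |>.2 fun i => ?_
    fin_cases i
    · exact (h 0).add (h' 0)
    · exact (h 1).add ((Complex.contDiff_exp.comp (h 0).neg).mul (h' 1))
    · exact (h 2).add ((Complex.contDiff_exp.comp (h 0)).mul (h' 2))
  contMDiff_inv := by
    rw [contMDiff_iff_contDiff]
    have h (i : Fin 3) : ContDiff ℂ ω fun p : SolvGroup => p i := contDiff_apply ℂ ℂ i
    refine contDiff_pi (E := SolvGroup) (F' := fun _ : Fin 3 => ℂ) |>.2 fun i => ?_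
    fin_cases i
    · exact (h 0).neg
    · exact ((Complex.contDiff_exp.comp (h 0)).mul (h 1)).neg
    · exact ((Complex.contDiff_exp.comp (h 0).neg).mul (h 2)).neg

end SolvGroup

end BismutHolonomy

end

open scoped ContDiff Manifold

noncomputable section

namespace BismutHolonomy

/-! ### Frames with constant structure functions -/

/-! A left-invariant unitary coframe turns the geometry into algebra on the Lie algebra. Let θ be
the frame coordinates, with dθ(u, v) = -ad(θu)θv. Koszul's formula gives the Levi-Civita connection.
Since the bracket is complex bilinear, adding half of the torsion J dF cancels one Koszul term and
leaves the connection matrix ad ξ - (ad ξ)ᴴ (`isBismut`). It is skew-Hermitian, and traceless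
because ad is, so parallel transport preserves the Hermitian product and the complex volume: the
holonomy lies in SU(3) (`exists_specialUnitary_of_isTransport`). The balanced condition is a
polynomial identity in the structure constants (`isBalanced_of_sum_eq_zero`).

The converse uses explicit loops instead of curvature. In each group, two of the frame fields are
constant along the complex lines they span. On such a line, transport by r·u with |u| = 1 is
exp(rK), where K is an infinitesimal rotation of a coordinate plane and K³ = -K; hence it is trivial
for r = 2π. A segment of any length up to 4π can be closed to a triangle by two segments of length
2π, so exp(rK) is the holonomy of a loop (`isTransportMatrix_rotation`). Varying u and r yields the
SU(2) of the plane (`mem_of_real_diagonal`). The planes are (1,2) and (0,2) for the Heisenberg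
group, (0,1) and (0,2) for the semidirect product; in both cases the two copies of SU(2) generate
SU(3) by column elimination. -/

/-- The real inner product `Re ⟨u, v⟩` on `ℂ³`. -/
def stdInner : (Fin 3 → ℂ) →L[ℝ] (Fin 3 → ℂ) →L[ℝ] ℝ :=
  LinearMap.toContinuousBilinearMap <| LinearMap.mk₂ ℝ
    (fun u v => ∑ i, ((u i).re * (v i).re + (u i).im * (v i).im))
    (fun u u' v => by simp [Fin.sum_univ_three]; ring)
    (fun c u v => by simp [Fin.sum_univ_three]; ring)
    (fun u v v' => by simp [Fin.sum_univ_three]; ring)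
    (fun c u v => by simp [Fin.sum_univ_three]; ring)

theorem stdInner_apply (u v : Fin 3 → ℂ) :
    stdInner u v = ∑ i, ((u i).re * (v i).re + (u i).im * (v i).im) := rfl

theorem stdInner_eq_re (u v : Fin 3 → ℂ) : stdInner u v = (star u ⬝ᵥ v).re := by
  simp [stdInner_apply, dotProduct]

theorem stdInner_comm (u v : Fin 3 → ℂ) : stdInner u v = stdInner v u := by
  simp only [stdInner_apply, mul_comm]

theorem stdInner_smul_I (u v : Fin 3 → ℂ) :
    stdInner (Complex.I • u) (Complex.I • v) = stdInner u v := by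
  simp [stdInner_apply, Fin.sum_univ_three]; ring

theorem stdInner_self_pos {u : Fin 3 → ℂ} (hu : u ≠ 0) : 0 < stdInner u u := by
  obtain ⟨i, hi⟩ := Function.ne_iff.1 hu
  rw [stdInner_apply]
  refine Finset.sum_pos' (fun j _ => by nlinarith [mul_self_nonneg (u j).re, mul_self_nonneg (u j).im])
    ⟨i, Finset.mem_univ i, ?_⟩
  have := Complex.normSq_pos.2 hi
  rwa [Complex.normSq_apply] at this

/-- The flat Hermitian metric of `ℂ³`. -/
def stdMetric : HermitianMetric (Fin 3 → ℂ) where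
  toFun _ := stdInner
  smooth := contDiff_const
  symm _ := stdInner_comm
  pos _ _ := stdInner_self_pos
  map_J _ := stdInner_smul_I

theorem stdInner_mulVec (M : Matrix (Fin 3) (Fin 3) ℂ) (u v : Fin 3 → ℂ) :
    stdInner (M.mulVec u) v = stdInner u (M.conjTranspose.mulVec v) := by
  rw [stdInner_eq_re, stdInner_eq_re, Matrix.star_mulVec, Matrix.dotProduct_mulVec]

theorem stdInner_conjTranspose_mulVec (M : Matrix (Fin 3) (Fin 3) ℂ) (u v : Fin 3 → ℂ) :
    stdInner (M.conjTranspose.mulVec u) v = stdInner u (M.mulVec v) := by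
  rw [stdInner_mulVec, Matrix.conjTranspose_conjTranspose]

/-- A holomorphic frame of the tangent bundle of `E`, given by the isomorphisms `θ x` from the
tangent spaces to `ℂ³`, whose brackets have constant coefficients and form a unimodular Lie algebra
with adjoint representation `ad`. -/
structure UnimodularFrame (E : Type*) [NormedAddCommGroup E] [NormedSpace ℂ E] where
  /-- The coordinates of tangent vectors with respect to the frame. -/
  θ : E → E ≃L[ℂ] (Fin 3 → ℂ)
  /-- The adjoint representation. -/
  ad : (Fin 3 → ℂ) →ₗ[ℂ] Matrix (Fin 3) (Fin 3) ℂ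
  contDiff : ContDiff ℂ ∞ fun x => (θ x : E →L[ℂ] (Fin 3 → ℂ))
  maurerCartan : ∀ x u v, fderiv ℂ (fun x => (θ x : E →L[ℂ] (Fin 3 → ℂ))) x u v
    - fderiv ℂ (fun x => (θ x : E →L[ℂ] (Fin 3 → ℂ))) x v u = - (ad (θ x u)).mulVec (θ x v)
  ad_skew : ∀ ξ η, (ad ξ).mulVec η = - (ad η).mulVec ξ
  trace_ad : ∀ ξ, (ad ξ).trace = 0

namespace UnimodularFrame

variable {E : Type*} [NormedAddCommGroup E] [NormedSpace ℂ E] (S : UnimodularFrame E)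

/-- The coframe `φ¹, φ², φ³`. -/
def coframe (i : Fin 3) (x : E) : E →L[ℂ] ℂ :=
  (ContinuousLinearMap.proj i).comp (S.θ x : E →L[ℂ] (Fin 3 → ℂ))

@[simp] theorem coframe_apply (i : Fin 3) (x v : E) : S.coframe i x v = S.θ x v i := rfl

theorem differentiable_coframe (i : Fin 3) : Differentiable ℂ (S.coframe i) := by
  have h := S.contDiff.differentiable (by simp)
  unfold coframe
  fun_prop

/-- The frame coordinates as a real linear map. -/
def toReal (x : E) : E →L[ℝ] (Fin 3 → ℂ) :=
  (S.θ x : E →L[ℂ] (Fin 3 → ℂ)).restrictScalars ℝ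

@[simp] theorem toReal_apply (x v : E) : S.toReal x v = S.θ x v := rfl

theorem contDiff_toReal : ContDiff ℝ ∞ S.toReal :=
  (ContinuousLinearMap.restrictScalarsL ℂ E (Fin 3 → ℂ) ℝ ℝ).contDiff.comp
    (S.contDiff.restrict_scalars ℝ)

theorem differentiableAt_toReal (x : E) : DifferentiableAt ℝ S.toReal x :=
  S.contDiff_toReal.differentiable (by simp) x

theorem fderiv_toReal (x u v : E) :
    fderiv ℝ S.toReal x u v = fderiv ℂ (fun x => (S.θ x : E →L[ℂ] (Fin 3 → ℂ))) x u v := by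
  have h := (S.contDiff.differentiable (by simp) x).hasFDerivAt.restrictScalars ℝ
  have h2 := (ContinuousLinearMap.restrictScalarsL ℂ E (Fin 3 → ℂ) ℝ ℝ).hasFDerivAt.comp x h
  have h3 : HasFDerivAt S.toReal _ x := h2
  rw [h3.fderiv]
  rfl

theorem maurerCartan_toReal (x u v : E) :
    fderiv ℝ S.toReal x u v - fderiv ℝ S.toReal x v u = - (S.ad (S.θ x u)).mulVec (S.θ x v) := by
  rw [fderiv_toReal, fderiv_toReal, S.maurerCartan]

/-- The Hermitian metric for which the frame is unitary. -/
def metric : HermitianMetric E where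
  toFun x := ((ContinuousLinearMap.compL ℝ E (Fin 3 → ℂ) ℝ).flip (S.toReal x)).comp
    (stdInner.comp (S.toReal x))
  smooth := by
    have h := S.contDiff_toReal
    exact ((ContinuousLinearMap.compL ℝ E (Fin 3 → ℂ) ℝ).flip.contDiff.comp h).clm_comp
      (contDiff_const.clm_comp h)
  symm x u v := stdInner_comm _ _
  pos x u hu := stdInner_self_pos (by simpa using hu)
  map_J x u v := by
    change stdInner (S.θ x _) (S.θ x _) = stdInner (S.θ x u) (S.θ x v)
    rw [(S.θ x).map_smul, (S.θ x).map_smul, stdInner_smul_I]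

theorem metric_apply (x u v : E) : S.metric.toFun x u v = stdInner (S.θ x u) (S.θ x v) := rfl

theorem isUnitaryCoframe : IsUnitaryCoframe S.metric S.coframe := fun _ _ _ => rfl

theorem fderiv_metric (x u v w : E) : fderiv ℝ S.metric.toFun x u v w =
    stdInner (fderiv ℝ S.toReal x u v) (S.θ x w)
      + stdInner (S.θ x v) (fderiv ℝ S.toReal x u w) := by
  have hm := (S.metric.smooth.differentiable (by simp) x).hasFDerivAt
  have h1 := (hm.clm_apply (hasFDerivAt_const v x)).clm_apply (hasFDerivAt_const w x)
  have hθ := (S.differentiableAt_toReal x).hasFDerivAt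
  have h2 := ((hasFDerivAt_const stdInner x).clm_apply
    (hθ.clm_apply (hasFDerivAt_const v x))).clm_apply (hθ.clm_apply (hasFDerivAt_const w x))
  have h := congrArg (fun L : E →L[ℝ] ℝ => L u) (h1.unique h2)
  simpa [add_comm] using h

/-! ### Levi-Civita and Bismut connections in the frame -/

/-- The affine connection which in the frame is given by `N`. -/
def connection (N : (Fin 3 → ℂ) →L[ℝ] (Fin 3 → ℂ) →L[ℝ] (Fin 3 → ℂ)) : Connection E := fun x =>
  (((S.θ x).symm : (Fin 3 → ℂ) →L[ℂ] E).restrictScalars ℝ).postcomp E ∘L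
    -- The derivative of θ is included so that θ(∇_X Y) = D(θY)(X) + N(θX, θY): `N` is the
    -- connection form relative to the frame.
    (fderiv ℝ S.toReal x + N.bilinearComp (S.toReal x) (S.toReal x))

theorem θ_connection (N : (Fin 3 → ℂ) →L[ℝ] (Fin 3 → ℂ) →L[ℝ] (Fin 3 → ℂ)) (x u v : E) :
    S.θ x (S.connection N x u v) = fderiv ℝ S.toReal x u v + N (S.θ x u) (S.θ x v) := by
  simp [connection]

/-- The Levi-Civita connection in the frame. -/
def leviCivitaForm : (Fin 3 → ℂ) →L[ℝ] (Fin 3 → ℂ) →L[ℝ] (Fin 3 → ℂ) :=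
  LinearMap.toContinuousBilinearMap <| LinearMap.mk₂ ℝ
    -- Koszul's formula; its derivative terms vanish because the frame has constant inner products.
    (fun ξ η => (1 / 2 : ℝ) • ((S.ad ξ).mulVec η - (S.ad ξ).conjTranspose.mulVec η
      - (S.ad η).conjTranspose.mulVec ξ))
    (fun u u' v => by
      rw [← smul_add]; congr 1; simp [Matrix.add_mulVec, Matrix.mulVec_add]; abel)
    (fun c u v => by
      rw [smul_comm]
      have : S.ad (c • u) = (c : ℂ) • S.ad u := S.ad.map_smul (c : ℂ) u
      congr 1
      ext i
      simp [this, Matrix.smul_mulVec, Matrix.mulVec_smul, mul_sub])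
    (fun u v v' => by
      rw [← smul_add]; congr 1; simp [Matrix.add_mulVec, Matrix.mulVec_add]; abel)
    (fun c u v => by
      rw [smul_comm]
      have : S.ad (c • v) = (c : ℂ) • S.ad v := S.ad.map_smul (c : ℂ) v
      congr 1
      ext i
      simp [this, Matrix.smul_mulVec, Matrix.mulVec_smul, mul_sub])

theorem leviCivitaForm_apply (ξ η : Fin 3 → ℂ) : S.leviCivitaForm ξ η =
    (1 / 2 : ℝ) • ((S.ad ξ).mulVec η - (S.ad ξ).conjTranspose.mulVec η
      - (S.ad η).conjTranspose.mulVec ξ) := rfl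

theorem stdInner_leviCivitaForm (ξ η ζ : Fin 3 → ℂ) : stdInner (S.leviCivitaForm ξ η) ζ =
    1 / 2 * (stdInner ((S.ad ξ).mulVec η) ζ - stdInner ((S.ad ξ).mulVec ζ) η
      - stdInner ((S.ad η).mulVec ζ) ξ) := by
  simp only [leviCivitaForm_apply, map_sub, map_smul, sub_apply, smul_apply, smul_eq_mul,
    stdInner_conjTranspose_mulVec]
  rw [stdInner_comm η, stdInner_comm ξ]

/-- The matrix of the Bismut connection in the frame, `ad ξ - (ad ξ)ᴴ`. -/
def bismutMatrix (ξ : Fin 3 → ℂ) : Matrix (Fin 3) (Fin 3) ℂ :=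
  S.ad ξ - (S.ad ξ).conjTranspose

/-- The Bismut connection in the frame. -/
def bismutForm : (Fin 3 → ℂ) →L[ℝ] (Fin 3 → ℂ) →L[ℝ] (Fin 3 → ℂ) :=
  LinearMap.toContinuousBilinearMap <| LinearMap.mk₂ ℝ
    (fun ξ η => (S.bismutMatrix ξ).mulVec η)
    (fun u u' v => by simp [bismutMatrix, Matrix.add_mulVec, Matrix.sub_mulVec]; abel)
    (fun c u v => by
      have : S.ad (c • u) = (c : ℂ) • S.ad u := S.ad.map_smul (c : ℂ) u
      ext i
      simp [bismutMatrix, this, Matrix.smul_mulVec, Matrix.sub_mulVec, mul_sub])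
    (fun u v v' => by simp [Matrix.mulVec_add])
    (fun c u v => by simp [Matrix.mulVec_smul])

theorem bismutForm_apply (ξ η : Fin 3 → ℂ) :
    S.bismutForm ξ η = (S.bismutMatrix ξ).mulVec η := rfl

/-- The antisymmetric part of the Koszul form is the bracket, which cancels the Maurer-Cartan term;
metricity holds because the form is skew for the inner product in its last two arguments. -/
theorem isLeviCivita : IsLeviCivita S.metric (S.connection S.leviCivitaForm) := by
  constructor
  · intro x u v
    apply (S.θ x).injective
    rw [θ_connection, θ_connection, leviCivitaForm_apply, leviCivitaForm_apply, ← sub_eq_zero]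
    have h := S.maurerCartan_toReal x u v
    have h' := S.ad_skew (S.θ x u) (S.θ x v)
    rw [add_sub_add_comm, h, ← smul_sub, S.ad_skew (S.θ x v)]
    ext i
    simp
    ring
  · intro x u v w
    rw [fderiv_metric, metric_apply, metric_apply, θ_connection, θ_connection]
    rw [stdInner_comm (S.θ x v) (_ + _)]
    simp only [map_add, add_apply, stdInner_leviCivitaForm]
    rw [S.ad_skew (S.θ x w) (S.θ x v), stdInner_comm (S.θ x v), map_neg, neg_apply]
    ring

end UnimodularFrame

/-! ### Exterior derivatives of forms with constant coefficients in the frame -/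

/-- Iterated, this writes a sum over the permutations of `Fin 4` as 24 explicit terms. -/
theorem sum_perm_fin_succ {M : Type*} [AddCommMonoid M] {n : ℕ} (f : Equiv.Perm (Fin (n + 1)) → M) :
    ∑ σ, f σ = ∑ p, ∑ e, f (Equiv.Perm.decomposeFin.symm (p, e)) := by
  rw [← Fintype.sum_prod_type', ← Equiv.Perm.decomposeFin.symm.sum_comp]

theorem _root_.ContinuousAlternatingMap.apply_pair_swap {E F : Type*} [NormedAddCommGroup E]
    [NormedSpace ℝ E] [NormedAddCommGroup F] [NormedSpace ℝ F] (β : E [⋀^Fin 2]→L[ℝ] F) (p q : E) :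
    β ![p, q] = - β ![q, p] := by
  have := β.toAlternatingMap.map_swap ![q, p] (i := 0) (j := 1) (by decide)
  refine Eq.trans (congrArg β ?_) this
  ext i
  fin_cases i <;> rfl

theorem _root_.ContinuousAlternatingMap.apply_pair_sub {E F : Type*} [NormedAddCommGroup E]
    [NormedSpace ℝ E] [NormedAddCommGroup F] [NormedSpace ℝ F] (β : E [⋀^Fin 2]→L[ℝ] F)
    (p q r : E) : β ![p - q, r] = β ![p, r] - β ![q, r] := by
  have u (z : E) : Function.update ![p, r] 0 z = ![z, r] := by
    ext i; fin_cases i <;> rfl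
  simpa only [u] using β.map_update_sub ![p, r] 0 p q

theorem HermitianMetric.wedgeSq_apply {E : Type*} [NormedAddCommGroup E] [NormedSpace ℂ E]
    (β : E [⋀^Fin 2]→L[ℝ] ℝ) (a b c d : E) :
    wedgeSq β ![a, b, c, d] = 2 * (β ![a, b] * β ![c, d] - β ![a, c] * β ![b, d]
      + β ![a, d] * β ![b, c]) := by
  have key : wedgeSq β ![a, b, c, d] = (1 / 4) * ∑ σ : Equiv.Perm (Fin 4), (Equiv.Perm.sign σ : ℤ) •
      (β ![![a, b, c, d] (σ 0), ![a, b, c, d] (σ (Fin.succ 0))] *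
        β ![![a, b, c, d] (σ (Fin.succ (Fin.succ 0))),
          ![a, b, c, d] (σ (Fin.succ (Fin.succ (Fin.succ 0))))]) := by
    rw [wedgeSq, ContinuousAlternatingMap.smul_apply,
      ContinuousMultilinearMap.alternatization_apply_apply]
    rfl
  rw [key]
  simp only [sum_perm_fin_succ, Equiv.Perm.decomposeFin.symm_sign,
    Equiv.Perm.decomposeFin_symm_apply_zero, Equiv.Perm.decomposeFin_symm_apply_succ,
    Fin.sum_univ_succ, Equiv.swap_apply_def]
  simp
  -- Once the arguments are put in increasing order, each of the three pairings occurs 8 times; the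
  -- factor 1/4 leaves 2.
  rw [β.apply_pair_swap b a, β.apply_pair_swap c a, β.apply_pair_swap d a, β.apply_pair_swap c b,
    β.apply_pair_swap d b, β.apply_pair_swap d c]
  ring

namespace UnimodularFrame

variable {E : Type*} [NormedAddCommGroup E] [NormedSpace ℂ E] (S : UnimodularFrame E)

/-- As `β` has constant coefficients, only θ is differentiated, and the Leibniz rule inserts its
derivative into each slot in turn. -/
theorem extDeriv_pullback_apply {n : ℕ} {F : Type*} [NormedAddCommGroup F] [NormedSpace ℝ F]
    (β : (Fin 3 → ℂ) [⋀^Fin n]→L[ℝ] F) (x : E) (v : Fin (n + 1) → E) :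
    extDeriv (fun y => β.compContinuousLinearMap (S.toReal y)) x v =
      ∑ i, (-1) ^ i.val • ∑ j, β (Function.update (fun k => S.θ x (i.removeNth v k)) j
        (fderiv ℝ S.toReal x (v i) (i.removeNth v j))) := by
  rw [extDeriv, ContinuousAlternatingMap.alternatizeUncurryFin_apply,
    fderiv_continuousAlternatingMapCompContinuousLinearMap (differentiableAt_const _)
      (S.differentiableAt_toReal x)]
  refine Finset.sum_congr rfl fun i _ => congrArg _ ?_
  simp
  refine Finset.sum_congr rfl fun j _ => congrArg _ ?_
  ext1 k
  rcases eq_or_ne k j with rfl | h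
  · simp
  · simp [h]

theorem extDeriv_coframe (i : Fin 3) (x u v : E) :
    extDeriv (oneForm (S.coframe i)) x ![u, v] = (- (S.ad (S.θ x u)).mulVec (S.θ x v)) i := by
  have h : oneForm (S.coframe i) = fun y => (ContinuousAlternatingMap.ofSubsingleton ℝ (Fin 3 → ℂ) ℂ
      (0 : Fin 1) (ContinuousLinearMap.proj i)).compContinuousLinearMap (S.toReal y) := rfl
  rw [h, extDeriv_pullback_apply, ← S.maurerCartan_toReal]
  simp [Fin.sum_univ_two, Fin.removeNth, sub_eq_add_neg]

/-- The Chevalley-Eilenberg formula: the derivatives of θ occur in antisymmetric pairs, which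
Maurer-Cartan turns into brackets. -/
theorem extDeriv_pullback_two {F : Type*} [NormedAddCommGroup F] [NormedSpace ℝ F]
    (β : (Fin 3 → ℂ) [⋀^Fin 2]→L[ℝ] F) (x u v w : E) :
    extDeriv (fun y => β.compContinuousLinearMap (S.toReal y)) x ![u, v, w] =
      -β ![(S.ad (S.θ x u)).mulVec (S.θ x v), S.θ x w]
      + β ![(S.ad (S.θ x u)).mulVec (S.θ x w), S.θ x v]
      - β ![(S.ad (S.θ x v)).mulVec (S.θ x w), S.θ x u] := by
  rw [extDeriv_pullback_apply, Fin.sum_univ_three]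
  have h (p q : E) : fderiv ℝ S.toReal x p q =
      fderiv ℝ S.toReal x q p - (S.ad (S.θ x p)).mulVec (S.θ x q) := by
    rw [sub_eq_add_neg, ← S.maurerCartan_toReal]; abel
  have u0 (p q r : Fin 3 → ℂ) : Function.update ![p, q] 0 r = ![r, q] := by
    ext1 i; fin_cases i <;> rfl
  have u1 (p q r : Fin 3 → ℂ) : Function.update ![p, q] 1 r = ![p, r] := by
    ext1 i; fin_cases i <;> rfl
  have hv (p q : E) : (fun k => S.θ x (![p, q] k)) = ![S.θ x p, S.θ x q] := by
    ext1 i; fin_cases i <;> rfl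
  have r0 : (0 : Fin 3).removeNth ![u, v, w] = ![v, w] := by ext1 i; fin_cases i <;> rfl
  have r1 : (1 : Fin 3).removeNth ![u, v, w] = ![u, w] := by ext1 i; fin_cases i <;> rfl
  have r2 : (2 : Fin 3).removeNth ![u, v, w] = ![u, v] := by ext1 i; fin_cases i <;> rfl
  simp only [Fin.sum_univ_two, r0, r1, r2, hv, u0, u1]
  simp
  -- Trading each derivative for its transpose minus a bracket makes all derivative terms cancel.
  rw [h u v, h u w, h v w, β.apply_pair_sub, β.apply_pair_swap _ (_ - _),
    β.apply_pair_sub, β.apply_pair_swap (S.θ x u) (_ - _), β.apply_pair_sub,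
    β.apply_pair_swap (S.θ x u) (fderiv ℝ S.toReal x w v)]
  abel

theorem kahlerForm_eq : S.metric.kahlerForm = fun y =>
    (stdMetric.kahlerForm 0).compContinuousLinearMap (S.toReal y) := by
  funext y
  ext m
  change stdInner (S.θ y (Complex.I • m 0)) _ = stdInner (Complex.I • S.θ y (m 0)) _
  rw [(S.θ y).map_smul]

theorem isBismut : IsBismut S.metric (S.connection S.bismutForm) := by
  refine ⟨_, S.isLeviCivita, fun x u v w => ?_⟩
  have hF (a b : Fin 3 → ℂ) : stdMetric.kahlerForm 0 ![a, b] = stdInner (Complex.I • a) b := rfl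
  -- By complex bilinearity [Ja, Jb] = -[a, b], so T(u, v, w) = ⟨[u,v],w⟩ - ⟨[u,w],v⟩ + ⟨[v,w],u⟩.
  -- Half of this cancels the last Koszul term and doubles the other two.
  have hI (a b : Fin 3 → ℂ) : (S.ad (Complex.I • a)).mulVec (Complex.I • b) =
      - (S.ad a).mulVec b := by
    rw [map_smul, Matrix.smul_mulVec, Matrix.mulVec_smul, smul_smul, Complex.I_mul_I, neg_one_smul]
  rw [HermitianMetric.bismutTorsion, S.kahlerForm_eq, extDeriv_pullback_two, metric_apply, metric_apply,
    θ_connection, θ_connection, (S.θ x).map_smul, (S.θ x).map_smul, (S.θ x).map_smul, hI, hI, hI,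
    hF, hF, hF, stdInner_smul_I, stdInner_smul_I, stdInner_smul_I, map_add, map_add, add_apply,
    add_apply, stdInner_leviCivitaForm, bismutForm_apply, bismutMatrix, Matrix.sub_mulVec,
    map_sub, sub_apply, stdInner_conjTranspose_mulVec, stdInner_comm (S.θ x v)]
  simp only [map_neg, neg_apply]
  ring

/-! ### The balanced condition -/

/-- Half the wedge square of the Kähler form of `ℂ³`. -/
def kahlerPair (a b c d : Fin 3 → ℂ) : ℝ :=
  stdInner (Complex.I • a) b * stdInner (Complex.I • c) d
    - stdInner (Complex.I • a) c * stdInner (Complex.I • b) d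
    + stdInner (Complex.I • a) d * stdInner (Complex.I • b) c

/-- In the frame, `d(F ∧ F)` is an alternating sum over the brackets. -/
theorem isBalanced_of_sum_eq_zero
    (hsum : ∀ a b c d e, kahlerPair ((S.ad a).mulVec b) c d e - kahlerPair ((S.ad a).mulVec c) b d e
      + kahlerPair ((S.ad a).mulVec d) b c e - kahlerPair ((S.ad a).mulVec e) b c d
      + kahlerPair ((S.ad b).mulVec c) a d e - kahlerPair ((S.ad b).mulVec d) a c e
      + kahlerPair ((S.ad b).mulVec e) a c d + kahlerPair ((S.ad c).mulVec d) a b e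
      - kahlerPair ((S.ad c).mulVec e) a b d + kahlerPair ((S.ad d).mulVec e) a b c = 0) :
    S.metric.IsBalanced := by
  intro x
  have hk : (fun y => HermitianMetric.wedgeSq (S.metric.kahlerForm y)) = fun y =>
      (HermitianMetric.wedgeSq (stdMetric.kahlerForm 0)).compContinuousLinearMap (S.toReal y) := by
    funext y
    ext m
    have hm : m = ![m 0, m 1, m 2, m 3] := by ext1 i; fin_cases i <;> rfl
    have hw : S.toReal y ∘ ![m 0, m 1, m 2, m 3] =
      ![S.θ y (m 0), S.θ y (m 1), S.θ y (m 2), S.θ y (m 3)] := by ext1 i; fin_cases i <;> rfl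
    rw [hm, ContinuousAlternatingMap.compContinuousLinearMap_apply, HermitianMetric.wedgeSq_apply]
    rw [hw, HermitianMetric.wedgeSq_apply, S.kahlerForm_eq]
    rfl
  ext v
  obtain ⟨a, b, c, d, e, rfl⟩ : ∃ a b c d e, v = ![a, b, c, d, e] :=
    ⟨v 0, v 1, v 2, v 3, v 4, by ext1 i; fin_cases i <;> rfl⟩
  have h (p q : E) : fderiv ℝ S.toReal x p q =
      fderiv ℝ S.toReal x q p - (S.ad (S.θ x p)).mulVec (S.θ x q) := by
    rw [sub_eq_add_neg, ← S.maurerCartan_toReal]; abel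
  have hv (p q r s : E) : (fun k => S.θ x (![p, q, r, s] k)) = ![S.θ x p, S.θ x q, S.θ x r, S.θ x s] := by
    ext1 i; fin_cases i <;> rfl
  have u0 (p q r s t : Fin 3 → ℂ) : Function.update ![p, q, r, s] 0 t = ![t, q, r, s] := by
    ext1 i; fin_cases i <;> rfl
  have u1 (p q r s t : Fin 3 → ℂ) : Function.update ![p, q, r, s] 1 t = ![p, t, r, s] := by
    ext1 i; fin_cases i <;> rfl
  have u2 (p q r s t : Fin 3 → ℂ) : Function.update ![p, q, r, s] 2 t = ![p, q, t, s] := by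
    ext1 i; fin_cases i <;> rfl
  have u3 (p q r s t : Fin 3 → ℂ) : Function.update ![p, q, r, s] 3 t = ![p, q, r, t] := by
    ext1 i; fin_cases i <;> rfl
  rw [hk, extDeriv_pullback_apply, Fin.sum_univ_five]
  have r0 : (0 : Fin 5).removeNth ![a, b, c, d, e] = ![b, c, d, e] := by
    ext1 i; fin_cases i <;> rfl
  have r1 : (1 : Fin 5).removeNth ![a, b, c, d, e] = ![a, c, d, e] := by
    ext1 i; fin_cases i <;> rfl
  have r2 : (2 : Fin 5).removeNth ![a, b, c, d, e] = ![a, b, d, e] := by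
    ext1 i; fin_cases i <;> rfl
  have r3 : (3 : Fin 5).removeNth ![a, b, c, d, e] = ![a, b, c, e] := by
    ext1 i; fin_cases i <;> rfl
  have r4 : (4 : Fin 5).removeNth ![a, b, c, d, e] = ![a, b, c, d] := by
    ext1 i; fin_cases i <;> rfl
  have hF (a b : Fin 3 → ℂ) : stdMetric.kahlerForm 0 ![a, b] = stdInner (Complex.I • a) b := rfl
  simp only [Fin.sum_univ_four, r0, r1, r2, r3, r4, hv, u0, u1, u2, u3]
  simp [HermitianMetric.wedgeSq_apply]
  rw [h a b, h a c, h a d, h a e, h b c, h b d, h b e, h c d, h c e, h d e]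
  set β := stdMetric.kahlerForm 0
  have sw (p q r : E) : β ![S.θ x p, fderiv ℝ S.toReal x q r]
      = - β ![fderiv ℝ S.toReal x q r, S.θ x p] := β.apply_pair_swap _ _
  have sw' (p q : E) (r : Fin 3 → ℂ) : β ![S.θ x p, (S.ad (S.θ x q)).mulVec r]
      = - β ![(S.ad (S.θ x q)).mulVec r, S.θ x p] := β.apply_pair_swap _ _
  have sub' (p : E) (q r : Fin 3 → ℂ) : β ![S.θ x p, q - r] = β ![S.θ x p, q] - β ![S.θ x p, r] := by
    rw [β.apply_pair_swap, β.apply_pair_sub, β.apply_pair_swap q, β.apply_pair_swap r]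
    ring
  simp only [β.apply_pair_sub, sub', sw, sw']
  simp only [kahlerPair, ← hF] at hsum
  -- The sign comes from Maurer-Cartan, the 2 from `wedgeSq` being twice `kahlerPair`.
  linear_combination -2 * hsum (S.θ x a) (S.θ x b) (S.θ x c) (S.θ x d) (S.θ x e)

end UnimodularFrame

/-! ### Generators of `SU(3)` -/

/-- The matrix of `SU(2)` with first column `(a, b)`, acting on the coordinates `0, 1`. -/
def su01 (a b : ℂ) : Matrix (Fin 3) (Fin 3) ℂ := !![a, -star b, 0; b, star a, 0; 0, 0, 1]

/-- The matrix of `SU(2)` with first column `(a, b)`, acting on the coordinates `0, 2`. -/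
def su02 (a b : ℂ) : Matrix (Fin 3) (Fin 3) ℂ := !![a, 0, -star b; 0, 1, 0; b, 0, star a]

/-- The matrix of `SU(2)` with first column `(a, b)`, acting on the coordinates `1, 2`. -/
def su12 (a b : ℂ) : Matrix (Fin 3) (Fin 3) ℂ := !![1, 0, 0; 0, a, -star b; 0, b, star a]

theorem su01_mul (a b c d : ℂ) :
    su01 a b * su01 c d = su01 (a * c - star b * d) (b * c + star a * d) := by
  ext i j
  fin_cases i <;> fin_cases j <;> simp [su01, Matrix.mul_apply, Fin.sum_univ_three] <;> ring

theorem su02_mul (a b c d : ℂ) :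
    su02 a b * su02 c d = su02 (a * c - star b * d) (b * c + star a * d) := by
  ext i j
  fin_cases i <;> fin_cases j <;> simp [su02, Matrix.mul_apply, Fin.sum_univ_three] <;> ring

theorem su12_mul (a b c d : ℂ) :
    su12 a b * su12 c d = su12 (a * c - star b * d) (b * c + star a * d) := by
  ext i j
  fin_cases i <;> fin_cases j <;> simp [su12, Matrix.mul_apply, Fin.sum_univ_three] <;> ring

theorem su01_one_zero : su01 1 0 = 1 := by
  ext i j
  fin_cases i <;> fin_cases j <;> simp [su01]

theorem su02_one_zero : su02 1 0 = 1 := by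
  ext i j
  fin_cases i <;> fin_cases j <;> simp [su02]

theorem su01_star_mul {a b : ℂ} (h : star a * a + star b * b = 1) :
    su01 (star a) (-b) * su01 a b = 1 := by
  rw [su01_mul, ← su01_one_zero]
  congr 1
  · rw [star_neg, neg_mul, sub_neg_eq_add, h]
  · rw [star_star]; ring

theorem su02_star_mul {a b : ℂ} (h : star a * a + star b * b = 1) :
    su02 (star a) (-b) * su02 a b = 1 := by
  rw [su02_mul, ← su02_one_zero]
  congr 1
  · rw [star_neg, neg_mul, sub_neg_eq_add, h]
  · rw [star_star]; ring

theorem su01_mem_specialUnitaryGroup {a b : ℂ} (h : star a * a + star b * b = 1) :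
    su01 a b ∈ Matrix.specialUnitaryGroup (Fin 3) ℂ := by
  rw [Matrix.mem_specialUnitaryGroup_iff, Matrix.mem_unitaryGroup_iff', ← su01_star_mul h]
  refine ⟨congrArg (· * _) ?_, ?_⟩
  · ext i j
    fin_cases i <;> fin_cases j <;> simp [su01, Matrix.star_apply]
  · rw [Matrix.det_fin_three]
    simp [su01] at h ⊢
    linear_combination h

theorem su02_mem_specialUnitaryGroup {a b : ℂ} (h : star a * a + star b * b = 1) :
    su02 a b ∈ Matrix.specialUnitaryGroup (Fin 3) ℂ := by
  rw [Matrix.mem_specialUnitaryGroup_iff, Matrix.mem_unitaryGroup_iff', ← su02_star_mul h]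
  refine ⟨congrArg (· * _) ?_, ?_⟩
  · ext i j
    fin_cases i <;> fin_cases j <;> simp [su02, Matrix.star_apply]
  · rw [Matrix.det_fin_three]
    simp [su02] at h ⊢
    linear_combination h

/-- Every element of `SU(2)` is a product of elements with real diagonal. -/
theorem mem_of_real_diagonal {M : Type*} [Monoid M] (H : Submonoid M) (T : ℂ → ℂ → M)
    (hT : ∀ a b c d, T a b * T c d = T (a * c - star b * d) (b * c + star a * d))
    (hH : ∀ (c : ℝ) (s : ℂ), (c : ℂ) * c + star s * s = 1 → T c s ∈ H)
    {a b : ℂ} (h : star a * a + star b * b = 1) : T a b ∈ H := by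
  obtain ⟨u, hu, hua⟩ : ∃ u : ℂ, star u * u = 1 ∧ a = u * (‖a‖ : ℝ) := by
    refine ⟨Complex.exp (Complex.arg a * Complex.I), ?_, ?_⟩
    · rw [Complex.star_def, ← Complex.normSq_eq_conj_mul_self, Complex.normSq_eq_norm_sq,
        Complex.norm_exp_ofReal_mul_I]
      simp
    · rw [mul_comm, Complex.norm_mul_exp_arg_mul_I]
  -- The factorization is T(a, b) = T(0, -1) T(0, u) T(‖a‖, ub), whose first two factors multiply to
  -- T(u, 0).
  have h0 : T (0 : ℝ) (-1) ∈ H := hH _ _ (by simp)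
  have h1 : T (0 : ℝ) u ∈ H := hH _ _ (by simpa using hu)
  have ha : star a * a = (‖a‖ : ℝ) * (‖a‖ : ℝ) := by
    rw [Complex.star_def, ← Complex.normSq_eq_conj_mul_self, Complex.normSq_eq_norm_sq]
    push_cast; ring
  have h2 : T (‖a‖ : ℝ) (u * b) ∈ H := hH _ _ (by
    rw [star_mul']; linear_combination h - ha + star b * b * hu)
  have := H.mul_mem (H.mul_mem h0 h1) h2
  rw [hT, hT] at this
  convert this using 2
  · simp at hu hua ⊢
    exact hua
  · simp at hu ⊢
    linear_combination -b * hu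

theorem star_mul_self_eq (a : ℂ) : star a * a = ((‖a‖ ^ 2 : ℝ) : ℂ) := by
  rw [Complex.star_def, ← Complex.normSq_eq_conj_mul_self, Complex.normSq_eq_norm_sq]

/-- Elimination on the middle column: an `su02` makes its entries 0 and 2 equal to ρ and 0, and an
`su01` then carries it to the middle basis vector. A special unitary matrix fixing that vector lies
in the SU(2) of the plane (0,2). -/
theorem specialUnitaryGroup_subset_of_su01_su02 (H : Submonoid (Matrix (Fin 3) (Fin 3) ℂ))
    (h01 : ∀ a b : ℂ, star a * a + star b * b = 1 → su01 a b ∈ H)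
    (h02 : ∀ a b : ℂ, star a * a + star b * b = 1 → su02 a b ∈ H)
    {U : Matrix (Fin 3) (Fin 3) ℂ} (hU : U ∈ Matrix.specialUnitaryGroup (Fin 3) ℂ) : U ∈ H := by
  have hcol : star (U 0 1) * U 0 1 + star (U 1 1) * U 1 1 + star (U 2 1) * U 2 1 = 1 := by
    have := congrFun (congrFun (Matrix.mem_unitaryGroup_iff'.1
      (Matrix.mem_specialUnitaryGroup_iff.1 hU).1) 1) 1
    simpa [Matrix.mul_apply, Fin.sum_univ_three, Matrix.star_apply] using this
  obtain ⟨ρ, hρ⟩ : ∃ ρ : ℝ, star (U 0 1) * U 0 1 + star (U 2 1) * U 2 1 = (ρ : ℂ) * ρ := by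
    refine ⟨√(‖U 0 1‖ ^ 2 + ‖U 2 1‖ ^ 2), ?_⟩
    rw [← Complex.ofReal_mul, Real.mul_self_sqrt (by positivity), star_mul_self_eq,
      star_mul_self_eq]
    push_cast; ring
  obtain ⟨a, b, hab, h0, h2⟩ : ∃ a b : ℂ, star a * a + star b * b = 1 ∧
      a * U 0 1 - star b * U 2 1 = ρ ∧ b * U 0 1 + star a * U 2 1 = 0 := by
    -- If ρ = 0 both entries already vanish and the identity serves; otherwise (a, b) is obtained by
    -- normalizing them.
    rcases eq_or_ne ρ 0 with rfl | hne
    · have hz : ‖U 0 1‖ ^ 2 + ‖U 2 1‖ ^ 2 = 0 := by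
        rw [star_mul_self_eq, star_mul_self_eq] at hρ
        simp only [Complex.ofReal_zero, mul_zero] at hρ
        exact_mod_cast hρ
      have h1 : U 0 1 = 0 := norm_eq_zero.1 (by nlinarith [sq_nonneg ‖U 0 1‖, sq_nonneg ‖U 2 1‖])
      have h2 : U 2 1 = 0 := norm_eq_zero.1 (by nlinarith [sq_nonneg ‖U 0 1‖, sq_nonneg ‖U 2 1‖])
      exact ⟨1, 0, by simp, by simp [h1], by simp [h2]⟩
    · have hc : (ρ : ℂ) ≠ 0 := by exact_mod_cast hne
      refine ⟨star (U 0 1) / ρ, -U 2 1 / ρ, ?_, ?_, ?_⟩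
      · simp at hρ ⊢
        field_simp
        linear_combination hρ
      · simp at hρ ⊢
        field_simp
        linear_combination hρ
      · simp
        field_simp
        ring
  have hc : star (U 1 1) * U 1 1 + star (ρ : ℂ) * ρ = 1 := by
    simp at hρ hcol ⊢
    linear_combination hcol - hρ
  obtain ⟨W, hW⟩ : ∃ W, W = su01 (U 1 1) ρ * (su02 a b * U) := ⟨_, rfl⟩
  have hWmem : W ∈ Matrix.specialUnitaryGroup (Fin 3) ℂ := by
    rw [hW]
    exact mul_mem (su01_mem_specialUnitaryGroup hc) (mul_mem (su02_mem_specialUnitaryGroup hab) hU)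
  have hW01 : W 0 1 = 0 := by
    rw [hW]
    simp [Matrix.mul_apply, Matrix.vecMul, dotProduct, Fin.sum_univ_three, su01, su02] at h0 h2 ⊢
    linear_combination U 1 1 * h0
  have hW11 : W 1 1 = 1 := by
    rw [hW]
    simp [Matrix.mul_apply, Matrix.vecMul, dotProduct, Fin.sum_univ_three, su01, su02] at h0 h2 hc ⊢
    linear_combination hc + ρ * h0
  have hW21 : W 2 1 = 0 := by
    rw [hW]
    simp [Matrix.mul_apply, Matrix.vecMul, dotProduct, Fin.sum_univ_three, su01, su02] at h0 h2 ⊢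
    linear_combination h2
  have hrow : star (W 1 0) * W 1 0 + star (W 1 2) * W 1 2 = 0 := by
    have := congrFun (congrFun (Matrix.mem_unitaryGroup_iff.1
      (Matrix.mem_specialUnitaryGroup_iff.1 hWmem).1) 1) 1
    simp [Matrix.mul_apply, Fin.sum_univ_three, Matrix.star_apply, hW11] at this ⊢
    linear_combination this
  rw [star_mul_self_eq, star_mul_self_eq] at hrow
  have hrow' : ‖W 1 0‖ ^ 2 + ‖W 1 2‖ ^ 2 = 0 := by exact_mod_cast hrow
  have hW10 : W 1 0 = 0 := norm_eq_zero.1 (by nlinarith [sq_nonneg ‖W 1 0‖, sq_nonneg ‖W 1 2‖])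
  have hW12 : W 1 2 = 0 := norm_eq_zero.1 (by nlinarith [sq_nonneg ‖W 1 0‖, sq_nonneg ‖W 1 2‖])
  have hdet := (Matrix.mem_specialUnitaryGroup_iff.1 hWmem).2
  rw [Matrix.det_fin_three, hW01, hW11, hW21, hW10, hW12] at hdet
  have horth (j : Fin 3) : star (W 0 0) * W 0 j + star (W 2 0) * W 2 j
      = (1 : Matrix (Fin 3) (Fin 3) ℂ) 0 j := by
    have := congrFun (congrFun (Matrix.mem_unitaryGroup_iff'.1
      (Matrix.mem_specialUnitaryGroup_iff.1 hWmem).1) 0) j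
    simpa [Matrix.mul_apply, Fin.sum_univ_three, Matrix.star_apply, hW10] using this
  have h00 : star (W 0 0) * W 0 0 + star (W 2 0) * W 2 0 = 1 := by simpa using horth 0
  have h02' : star (W 0 0) * W 0 2 + star (W 2 0) * W 2 2 = 0 := by simpa using horth 2
  -- Orthogonality to the first column and determinant 1 form a linear system that determines the
  -- last column.
  have hW22 : W 2 2 = star (W 0 0) := by
    linear_combination -W 2 2 * h00 + star (W 0 0) * hdet + W 2 0 * h02'
  have hW02 : W 0 2 = -star (W 2 0) := by
    linear_combination -W 0 2 * h00 - star (W 2 0) * hdet + W 0 0 * h02'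
  have hWeq : W = su02 (W 0 0) (W 2 0) := by
    ext i j
    fin_cases i <;> fin_cases j <;> simp [su02, hW01, hW11, hW21, hW10, hW12, hW22, hW02]
  have hUeq : U = su02 (star a) (-b) * (su01 (star (U 1 1)) (-ρ) * W) := by
    rw [hW, ← mul_assoc (su01 _ _), su01_star_mul hc, one_mul, ← mul_assoc, su02_star_mul hab,
      one_mul]
  rw [hUeq]
  refine H.mul_mem (h02 _ _ ?_) (H.mul_mem (h01 _ _ ?_) (hWeq ▸ h02 _ _ h00))
  · simp at hab ⊢; linear_combination hab
  · simp at hc ⊢; linear_combination hc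

theorem specialUnitaryGroup_subset_of_su12_su02 (H : Submonoid (Matrix (Fin 3) (Fin 3) ℂ))
    (h12 : ∀ a b : ℂ, star a * a + star b * b = 1 → su12 a b ∈ H)
    (h02 : ∀ a b : ℂ, star a * a + star b * b = 1 → su02 a b ∈ H)
    {U : Matrix (Fin 3) (Fin 3) ℂ} (hU : U ∈ Matrix.specialUnitaryGroup (Fin 3) ℂ) : U ∈ H := by
  refine specialUnitaryGroup_subset_of_su01_su02 H (fun a b hab => ?_) h02 hU
  -- The elements `su02 0 (±1)` exchange the coordinates 0 and 2 up to sign, so conjugation carries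
  -- the plane (1,2) to (0,1).
  have : su01 a b = su02 0 (-1) * su12 (star a) (-star b) * su02 0 1 := by
    ext i j
    fin_cases i <;> fin_cases j <;>
      simp [su01, su02, su12, Matrix.mul_apply, Fin.sum_univ_three]
  rw [this]
  refine H.mul_mem (H.mul_mem (h02 _ _ (by simp)) (h12 _ _ ?_)) (h02 _ _ (by simp))
  simp at hab ⊢; linear_combination hab

/-- An isosceles triangle: with cos α = ‖z‖/2, the two unit vectors have arguments arg z ± α. They
will close the transport loops. -/
theorem exists_unit_add_unit (z : ℂ) (hz : ‖z‖ ≤ 2) : ∃ v w : ℂ, ‖v‖ = 1 ∧ ‖w‖ = 1 ∧ v + w = z := by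
  have hcos : Real.cos (Real.arccos (‖z‖ / 2)) = ‖z‖ / 2 :=
    Real.cos_arccos (by linarith [norm_nonneg z]) (by linarith)
  refine ⟨Complex.exp (((Complex.arg z + Real.arccos (‖z‖ / 2) : ℝ) : ℂ) * Complex.I),
    Complex.exp (((Complex.arg z - Real.arccos (‖z‖ / 2) : ℝ) : ℂ) * Complex.I),
    Complex.norm_exp_ofReal_mul_I _, Complex.norm_exp_ofReal_mul_I _, ?_⟩
  have h : Complex.cos (Real.arccos (‖z‖ / 2) : ℝ) = ((‖z‖ / 2 : ℝ) : ℂ) := by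
    rw [← Complex.ofReal_cos, hcos]
  conv_rhs => rw [← Complex.norm_mul_exp_arg_mul_I z]
  have h2 := Complex.two_cos (Real.arccos (‖z‖ / 2) : ℝ)
  push_cast at h h2 ⊢
  rw [add_mul, sub_mul, Complex.exp_add, sub_eq_add_neg, Complex.exp_add, ← neg_mul]
  rw [h] at h2
  linear_combination -Complex.exp (Complex.arg z * Complex.I) * h2

/-! ### Parallel transport in the frame -/

theorem eq_of_hasDerivWithinAt_zero {F : Type*} [NormedAddCommGroup F] [NormedSpace ℝ F]
    {f : ℝ → F} (h : ∀ t ∈ Set.Icc (0 : ℝ) 1, HasDerivWithinAt f 0 (Set.Icc 0 1) t) :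
    f 1 = f 0 :=
  constant_of_derivWithin_zero (fun t ht => (h t ht).differentiableWithinAt)
    (fun t ht => (h t (Set.Ico_subset_Icc_self ht)).derivWithin
      (uniqueDiffOn_Icc zero_lt_one t (Set.Ico_subset_Icc_self ht))) 1 (by simp)

/-- A linear differential equation with skew-Hermitian coefficients preserves the Hermitian
product. -/
theorem star_dotProduct_eq_of_skew {M : ℝ → Matrix (Fin 3) (Fin 3) ℂ} {f h : ℝ → Fin 3 → ℂ}
    (hM : ∀ t, (M t).conjTranspose = - M t)
    (hf : ∀ t ∈ Set.Icc (0 : ℝ) 1, HasDerivWithinAt f (-(M t).mulVec (f t)) (Set.Icc 0 1) t)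
    (hh : ∀ t ∈ Set.Icc (0 : ℝ) 1, HasDerivWithinAt h (-(M t).mulVec (h t)) (Set.Icc 0 1) t) :
    star (f 1) ⬝ᵥ h 1 = star (f 0) ⬝ᵥ h 0 := by
  refine eq_of_hasDerivWithinAt_zero (f := fun t => star (f t) ⬝ᵥ h t) fun t ht => ?_
  have h1 := hasDerivWithinAt_pi.1 (hf t ht)
  have h2 := hasDerivWithinAt_pi.1 (hh t ht)
  have h3 := HasDerivWithinAt.fun_sum (u := Finset.univ) fun i _ => ((h1 i).star).mul (h2 i)
  have h4 : HasDerivWithinAt (fun t => star (f t) ⬝ᵥ h t) _ (Set.Icc 0 1) t := h3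
  refine h4.congr_deriv ?_
  rw [Finset.sum_add_distrib]
  change star (-(M t).mulVec (f t)) ⬝ᵥ h t + star (f t) ⬝ᵥ (-(M t).mulVec (h t)) = 0
  rw [star_neg, Matrix.star_mulVec, neg_dotProduct, ← Matrix.dotProduct_mulVec, hM,
    Matrix.neg_mulVec, dotProduct_neg]
  ring

/-- A linear differential equation with traceless coefficients preserves the volume. -/
theorem det_eq_of_traceless {M : ℝ → Matrix (Fin 3) (Fin 3) ℂ} {f : Fin 3 → ℝ → Fin 3 → ℂ}
    (hM : ∀ t, (M t).trace = 0)
    (hf : ∀ j, ∀ t ∈ Set.Icc (0 : ℝ) 1,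
      HasDerivWithinAt (f j) (-(M t).mulVec (f j t)) (Set.Icc 0 1) t) :
    (Matrix.of fun i j => f j 1 i).det = (Matrix.of fun i j => f j 0 i).det := by
  refine eq_of_hasDerivWithinAt_zero (f := fun t => (Matrix.of fun i j => f j t i).det)
    fun t ht => ?_
  have h (j i : Fin 3) := hasDerivWithinAt_pi.1 (hf j t ht) i
  simp only [Matrix.det_fin_three, Matrix.of_apply]
  refine ((((((((h 0 0).mul (h 1 1)).mul (h 2 2)).sub (((h 0 0).mul (h 2 1)).mul (h 1 2))).sub
    (((h 1 0).mul (h 0 1)).mul (h 2 2))).add (((h 1 0).mul (h 2 1)).mul (h 0 2))).add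
    (((h 2 0).mul (h 0 1)).mul (h 1 2))).sub (((h 2 0).mul (h 1 1)).mul (h 0 2))).congr_deriv ?_
  have htr := hM t
  rw [Matrix.trace_fin_three] at htr
  simp only [Pi.neg_apply, Matrix.mulVec, dotProduct, Fin.sum_univ_three, Pi.mul_apply]
  have hdet := Matrix.det_fin_three (Matrix.of fun i j => f j t i)
  simp only [Matrix.of_apply] at hdet
  -- Liouville's formula: the derivative of the determinant is -tr(M) times the determinant.
  linear_combination -(Matrix.of fun i j => f j t i).det * htr
    + (M t 0 0 + M t 1 1 + M t 2 2) * hdet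

/-- The exponential of `r • K` when `K ^ 3 = -K`. -/
def matrixRotation (K : Matrix (Fin 3) (Fin 3) ℂ) (r : ℝ) : Matrix (Fin 3) (Fin 3) ℂ :=
  1 + Real.sin r • K + (1 - Real.cos r) • (K * K)

theorem matrixRotation_two_pi (K : Matrix (Fin 3) (Fin 3) ℂ) : matrixRotation K (2 * Real.pi) = 1 := by
  simp [matrixRotation]

/-- Because K³ = -K, multiplying `matrixRotation K s` by K gives cos s · K + sin s · K², its
derivative in s. -/
theorem hasDerivAt_matrixRotation_mulVec {K : Matrix (Fin 3) (Fin 3) ℂ} (hK : K * K * K = -K) (r t : ℝ)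
    (η : Fin 3 → ℂ) : HasDerivAt (fun t => (matrixRotation K (t * r)).mulVec η)
      ((r • K).mulVec ((matrixRotation K (t * r)).mulVec η)) t := by
  have e (t : ℝ) : (matrixRotation K (t * r)).mulVec η = η + Real.sin (t * r) • K.mulVec η
      + (1 - Real.cos (t * r)) • (K * K).mulVec η := by
    simp [matrixRotation, Matrix.add_mulVec, Matrix.smul_mulVec]
  simp only [e]
  have hl : HasDerivAt (fun t : ℝ => t * r) r t := by simpa using (hasDerivAt_id t).mul_const r
  refine (((hl.sin.smul_const (K.mulVec η)).const_add η).add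
    ((hl.cos.const_sub 1).smul_const ((K * K).mulVec η))).congr_deriv ?_
  rw [Matrix.smul_mulVec, Matrix.mulVec_add, Matrix.mulVec_add, Matrix.mulVec_smul,
    Matrix.mulVec_smul, Matrix.mulVec_mulVec, Matrix.mulVec_mulVec, ← mul_assoc, hK,
    Matrix.neg_mulVec]
  module

namespace UnimodularFrame

variable {E : Type*} [NormedAddCommGroup E] [NormedSpace ℂ E] (S : UnimodularFrame E)

theorem conjTranspose_bismutMatrix (ξ : Fin 3 → ℂ) :
    (S.bismutMatrix ξ).conjTranspose = - S.bismutMatrix ξ := by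
  simp [bismutMatrix]

theorem trace_bismutMatrix (ξ : Fin 3 → ℂ) : (S.bismutMatrix ξ).trace = 0 := by
  simp [bismutMatrix, Matrix.trace_sub, Matrix.trace_conjTranspose, S.trace_ad]

/-- The Bismut connection. -/
def bismut : Connection E := S.connection S.bismutForm

theorem θ_bismut (x u v : E) : S.θ x (S.bismut x u v) =
    fderiv ℝ S.toReal x u v + (S.bismutMatrix (S.θ x u)).mulVec (S.θ x v) :=
  S.θ_connection _ x u v

theorem hasDerivWithinAt_θ {s : Set ℝ} {γ V : ℝ → E} {γ' V' : E} {t : ℝ}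
    (hγ : HasDerivWithinAt γ γ' s t) (hV : HasDerivWithinAt V V' s t) :
    HasDerivWithinAt (fun t => S.θ (γ t) (V t))
      (fderiv ℝ S.toReal (γ t) γ' (V t) + S.θ (γ t) V') s t :=
  ((S.differentiableAt_toReal (γ t)).hasFDerivAt.comp_hasDerivWithinAt t hγ).clm_apply hV

theorem hasDerivWithinAt_θ_of_parallel {γ V : ℝ → E} (hγ : ContDiffOn ℝ ∞ γ (Set.Icc 0 1))
    (hV : IsParallelAlong S.bismut γ V) {t : ℝ} (ht : t ∈ Set.Icc (0 : ℝ) 1) :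
    HasDerivWithinAt (fun t => S.θ (γ t) (V t))
      (-(S.bismutMatrix (S.θ (γ t) (derivWithin γ (Set.Icc 0 1) t))).mulVec (S.θ (γ t) (V t)))
      (Set.Icc 0 1) t := by
  refine (S.hasDerivWithinAt_θ ((hγ.differentiableOn (by simp)) t ht).hasDerivWithinAt
    (hV t ht)).congr_deriv ?_
  rw [map_neg, θ_bismut]
  abel

/-! ### Holonomy is contained in SU(3) -/

/-- `U` is the matrix in the frame of the parallel transport along some curve from `x` to `y`. -/
def IsTransportMatrix (x y : E) (U : Matrix (Fin 3) (Fin 3) ℂ) : Prop :=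
  ∃ A, IsTransport S.bismut x y A ∧ ∀ v, S.θ y (A v) = U.mulVec (S.θ x v)

theorem IsTransportMatrix.mul {S : UnimodularFrame E} {x y z : E} {U W : Matrix (Fin 3) (Fin 3) ℂ}
    (hU : S.IsTransportMatrix x y U) (hW : S.IsTransportMatrix y z W) :
    S.IsTransportMatrix x z (W * U) := by
  obtain ⟨A, hA, hAU⟩ := hU
  obtain ⟨B, hB, hBW⟩ := hW
  exact ⟨B.comp A, hA.concat hB, fun v => by simp [hBW, hAU]⟩

/-- Parallel transport acts in the frame by a matrix of `SU(3)`. -/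
theorem exists_specialUnitary_of_isTransport {x y : E} {A : E →L[ℝ] E}
    (hA : IsTransport S.bismut x y A) :
    ∃ U ∈ Matrix.specialUnitaryGroup (Fin 3) ℂ, ∀ v, S.θ y (A v) = U.mulVec (S.θ x v) := by
  induction hA with
  | smooth γ hγ A hA =>
    choose V hV hV0 hV1 using hA
    let M (t : ℝ) := S.bismutMatrix (S.θ (γ t) (derivWithin γ (Set.Icc 0 1) t))
    let f (v : E) (t : ℝ) := S.θ (γ t) (V v t)
    have hf (v : E) : ∀ t ∈ Set.Icc (0 : ℝ) 1,
        HasDerivWithinAt (f v) (-(M t).mulVec (f v t)) (Set.Icc 0 1) t := fun t ht =>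
      S.hasDerivWithinAt_θ_of_parallel hγ (hV v) ht
    let b (j : Fin 3) : E := (S.θ (γ 0)).symm (Pi.single j 1)
    let U : Matrix (Fin 3) (Fin 3) ℂ := Matrix.of fun i j => f (b j) 1 i
    have hb (j : Fin 3) : f (b j) 0 = Pi.single j 1 := by simp [f, b, hV0]
    -- The columns of `U` are the end values of the solutions starting at the frame vectors.
    -- Conservation of the products with them determines `f v 1` from `f v 0`, which also gives
    -- complex linearity; no uniqueness theorem for the equation is needed.
    have hinner (v : E) : U.conjTranspose.mulVec (f v 1) = f v 0 := by
      ext j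
      have := star_dotProduct_eq_of_skew (fun t => S.conjTranspose_bismutMatrix _) (hf (b j)) (hf v)
      rw [hb] at this
      refine this.trans ?_
      rw [← Pi.single_star, star_one, single_one_dotProduct]
    have hUU : U.conjTranspose * U = 1 := by
      ext i j
      have := congrFun (hinner (b j)) i
      rw [hb] at this
      rw [Matrix.one_apply, ← Pi.single_apply, ← this]
      rfl
    refine ⟨U, Matrix.mem_specialUnitaryGroup_iff.2 ⟨Matrix.mem_unitaryGroup_iff'.2 hUU, ?_⟩,
      fun v => ?_⟩
    · refine (det_eq_of_traceless (f := fun j => f (b j)) (fun t => S.trace_bismutMatrix _)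
        fun j => hf (b j)).trans ?_
      rw [← Matrix.det_one (n := Fin 3) (R := ℂ)]
      congr 1
      ext i j
      simp [hb, Pi.single_apply, Matrix.one_apply]
    · have h1 : f v 1 = S.θ (γ 1) (A v) := by simp [f, hV1]
      have h0 : f v 0 = S.θ (γ 0) v := by simp [f, hV0]
      rw [← h1, ← h0, ← hinner, Matrix.mulVec_mulVec, mul_eq_one_comm.1 hUU, Matrix.one_mulVec]
  | concat hA hB ihA ihB =>
    obtain ⟨U, hU, hAU⟩ := ihA
    obtain ⟨W, hW, hBW⟩ := ihB
    exact ⟨W * U, mul_mem hW hU, fun v => by simp [hBW, hAU]⟩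

theorem holonomyGroup_subset (p : E) :
    holonomyGroup S.bismut p ⊆ specialUnitary S.coframe p := fun _ hA =>
  S.exists_specialUnitary_of_isTransport hA

theorem specialUnitary_subset_holonomyGroup {p : E}
    (h : ∀ U ∈ Matrix.specialUnitaryGroup (Fin 3) ℂ, S.IsTransportMatrix p p U) :
    specialUnitary S.coframe p ⊆ holonomyGroup S.bismut p := by
  rintro A ⟨U, hU, hA⟩
  obtain ⟨B, hB, hBU⟩ := h U hU
  have : A = B := by
    ext v
    apply (S.θ p).injective
    rw [hBU, ← show _ = U.mulVec (S.θ p v) from hA v]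
    rfl
  exact this ▸ hB

/-! ### Transport along segments and triangular loops -/

theorem differentiable_θ_symm :
    Differentiable ℂ fun x => ((S.θ x).symm : (Fin 3 → ℂ) →L[ℂ] E) := by
  intro x
  have : FiniteDimensional ℂ E := (S.θ x).symm.toLinearEquiv.finiteDimensional
  have : CompleteSpace E := FiniteDimensional.complete ℂ E
  have h := (contDiffAt_map_inverse (n := 1) (S.θ x)).differentiableAt (by simp)
  have h2 := h.comp x (S.contDiff.differentiable (by simp) x)
  refine h2.congr_of_eventuallyEq (Filter.Eventually.of_forall fun y => ?_)
  simp

/-- Parallel transport along a straight segment whose velocity is constant in the frame. -/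
theorem isTransportMatrix_segment {x w : E} {K : Matrix (Fin 3) (Fin 3) ℂ} {r : ℝ}
    (hK : K * K * K = -K) (hw : S.bismutMatrix (S.θ x w) = -(r • K))
    (hline : ∀ t : ℝ, S.θ (x + t • w) w = S.θ x w) :
    S.IsTransportMatrix x (x + w) (matrixRotation K r) := by
  let γ (t : ℝ) : E := x + t • w
  have hγ (t : ℝ) : HasDerivAt γ w t :=
    (((hasDerivAt_id t).smul_const w).const_add x).congr_deriv (one_smul ℝ w)
  let f (v : E) (t : ℝ) : Fin 3 → ℂ := (matrixRotation K (t * r)).mulVec (S.θ x v)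
  have hpar (v : E) : IsParallelAlong S.bismut γ fun t => (S.θ (γ t)).symm (f v t) := by
    intro t ht
    have hf := (hasDerivAt_matrixRotation_mulVec hK r t (S.θ x v)).hasDerivWithinAt (s := Set.Icc 0 1)
    have hsymm := (((S.differentiable_θ_symm (γ t)).hasFDerivAt.restrictScalars ℝ)
      |>.comp_hasDerivAt t (hγ t)).hasDerivWithinAt (s := Set.Icc 0 1)
    -- Differentiability suffices: the derivative of the field is then found by comparing the
    -- product rule for θ applied to it with the known derivative of `f`.
    have hd : DifferentiableWithinAt ℝ (fun t => (S.θ (γ t)).symm (f v t)) (Set.Icc 0 1) t := by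
      have hsymm' := ((ContinuousLinearMap.restrictScalarsL ℂ (Fin 3 → ℂ) E ℝ ℝ).hasFDerivAt
        |>.comp_hasDerivWithinAt t hsymm)
      exact (hsymm'.clm_apply hf).differentiableWithinAt
    have hV := hd.hasDerivWithinAt
    have h1 := S.hasDerivWithinAt_θ (hγ t).hasDerivWithinAt hV
    have hu : UniqueDiffWithinAt ℝ (Set.Icc (0 : ℝ) 1) t := uniqueDiffOn_Icc zero_lt_one t ht
    have h2 := hu.eq_deriv _ h1 (hf.congr_of_eventuallyEq (Filter.Eventually.of_forall fun s => by simp [f])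
      (by simp [f]))
    rw [(hγ t).hasDerivWithinAt.derivWithin hu]
    refine hV.congr_deriv ((S.θ (γ t)).injective ?_)
    rw [map_neg, θ_bismut, hline, hw, ContinuousLinearEquiv.apply_symm_apply, Matrix.neg_mulVec]
    rw [← eq_sub_iff_add_eq'] at h2
    rw [h2]
    abel
  let A : E →L[ℝ] E := ((((S.θ (x + w)).symm : (Fin 3 → ℂ) →L[ℂ] E).comp
    (Matrix.mulVecLin (matrixRotation K r)).toContinuousLinearMap).comp
      (S.θ x : E →L[ℂ] (Fin 3 → ℂ))).restrictScalars ℝ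
  refine ⟨A, ?_, fun v => by simp [A]⟩
  have h := IsTransport.smooth (Γ := S.bismut) γ
    ((contDiff_const.add (contDiff_id.smul contDiff_const)).contDiffOn) A
    fun v => ⟨_, hpar v, by simp [γ, f, matrixRotation], by simp [γ, f, A]⟩
  simpa [γ] using h

/-- The `k`-th field of the dual frame is constant along the complex lines it spans. -/
def IsStraight (k : Fin 3) : Prop :=
  ∀ x (a b : ℂ), (S.θ (x + (S.θ x).symm (Pi.single k a))).symm (Pi.single k b) =
    (S.θ x).symm (Pi.single k b)

/-- The loop goes back along two segments with trivial parallel transport. -/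
theorem isTransportMatrix_rotation {k : Fin 3} (hk : S.IsStraight k)
    {K : ℂ → Matrix (Fin 3) (Fin 3) ℂ} (hK : ∀ u, ‖u‖ = 1 → K u * K u * K u = - K u)
    (hKb : ∀ (r : ℝ) (u : ℂ), S.bismutMatrix (Pi.single k (r * u)) = -(r • K u))
    (x : E) {r : ℝ} (hr : |r| ≤ 4 * Real.pi) {u : ℂ} (hu : ‖u‖ = 1) :
    S.IsTransportMatrix x x (matrixRotation (K u) r) := by
  have seg (y : E) (r : ℝ) (u : ℂ) (hu : ‖u‖ = 1) :
      S.IsTransportMatrix y (y + (S.θ y).symm (Pi.single k (r * u))) (matrixRotation (K u) r) := by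
    refine S.isTransportMatrix_segment (hK u hu) (by simp [hKb]) fun t => ?_
    have h := hk y (t * (r * u)) (r * u)
    have ht : (S.θ y).symm (Pi.single k (t * (r * u)))
        = t • (S.θ y).symm (Pi.single k (r * u)) := by
      rw [← smul_eq_mul (t : ℂ), Pi.single_smul, map_smul]
      rfl
    rw [ht] at h
    simpa using (congrArg (S.θ (y + t • (S.θ y).symm (Pi.single k (r * u)))) h).symm
  have hpi := Real.pi_pos
  -- The return path must satisfy 2πv + 2πw = -ru, which has unit solutions exactly when |r| ≤ 4π.
  obtain ⟨v, w, hv, hw, hvw⟩ := exists_unit_add_unit (-(r / (2 * Real.pi) : ℝ) * u) (by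
    rw [norm_mul, norm_neg, hu, Complex.norm_real, Real.norm_eq_abs, abs_div,
      abs_of_pos (by positivity : 0 < 2 * Real.pi), mul_one, div_le_iff₀ (by positivity)]
    linarith)
  have h1 := seg x r u hu
  have h2 := seg (x + (S.θ x).symm (Pi.single k (r * u))) (2 * Real.pi) v hv
  -- Straightness expresses the displacement from the new base point in the frame at `x`, so that
  -- displacements add up.
  rw [hk] at h2
  have h12 := h1.mul h2
  rw [add_assoc, ← map_add, ← Pi.single_add] at h12
  have h3 := seg (x + (S.θ x).symm (Pi.single k (r * u + (2 * Real.pi : ℝ) * v))) (2 * Real.pi) w hw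
  rw [hk] at h3
  have h123 := h12.mul h3
  rw [matrixRotation_two_pi, matrixRotation_two_pi, one_mul, one_mul, add_assoc, ← map_add,
    ← Pi.single_add] at h123
  have hz : (r : ℂ) * u + (2 * Real.pi : ℝ) * v + (2 * Real.pi : ℝ) * w = 0 := by
    have hpi' : (Real.pi : ℂ) ≠ 0 := by exact_mod_cast hpi.ne'
    rw [add_assoc, ← mul_add, hvw]
    push_cast
    field_simp
    ring
  rw [hz] at h123
  simpa using h123

/-- The matrices of parallel transports along loops at `x`. -/
def holonomyMatrices (x : E) (h1 : S.IsTransportMatrix x x 1) :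
    Submonoid (Matrix (Fin 3) (Fin 3) ℂ) where
  carrier := {U | S.IsTransportMatrix x x U}
  mul_mem' hU hW := hW.mul hU
  one_mem' := h1

end UnimodularFrame

/-! ### Rotations in coordinate planes -/

/-- Infinitesimal rotation of the coordinates `0, 1`. -/
def gen01 (u : ℂ) : Matrix (Fin 3) (Fin 3) ℂ := !![0, -star u, 0; u, 0, 0; 0, 0, 0]

/-- Infinitesimal rotation of the coordinates `0, 2`. -/
def gen02 (u : ℂ) : Matrix (Fin 3) (Fin 3) ℂ := !![0, 0, -star u; 0, 0, 0; u, 0, 0]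

/-- Infinitesimal rotation of the coordinates `1, 2`. -/
def gen12 (u : ℂ) : Matrix (Fin 3) (Fin 3) ℂ := !![0, 0, 0; 0, 0, -star u; 0, u, 0]

theorem star_mul_self_of_norm_eq_one {u : ℂ} (hu : ‖u‖ = 1) : star u * u = 1 := by
  rw [star_mul_self_eq, hu]; simp

theorem gen01_cube {u : ℂ} (hu : ‖u‖ = 1) : gen01 u * gen01 u * gen01 u = - gen01 u := by
  have h := star_mul_self_of_norm_eq_one hu
  simp at h
  ext i j
  fin_cases i <;> fin_cases j <;> simp [gen01, Matrix.mul_apply, Fin.sum_univ_three]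
  · linear_combination (starRingEnd ℂ) u * h
  · linear_combination u * h

theorem gen02_cube {u : ℂ} (hu : ‖u‖ = 1) : gen02 u * gen02 u * gen02 u = - gen02 u := by
  have h := star_mul_self_of_norm_eq_one hu
  simp at h
  ext i j
  fin_cases i <;> fin_cases j <;> simp [gen02, Matrix.mul_apply, Fin.sum_univ_three]
  · linear_combination (starRingEnd ℂ) u * h
  · linear_combination u * h

theorem gen12_cube {u : ℂ} (hu : ‖u‖ = 1) : gen12 u * gen12 u * gen12 u = - gen12 u := by
  have h := star_mul_self_of_norm_eq_one hu
  simp at h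
  ext i j
  fin_cases i <;> fin_cases j <;> simp [gen12, Matrix.mul_apply, Fin.sum_univ_three]
  · linear_combination (starRingEnd ℂ) u * h
  · linear_combination u * h

theorem matrixRotation_gen01 {u : ℂ} (hu : ‖u‖ = 1) (r : ℝ) :
    matrixRotation (gen01 u) r = su01 (Real.cos r : ℝ) (Real.sin r * u) := by
  have h := star_mul_self_of_norm_eq_one hu
  simp only [Complex.star_def] at h
  simp only [matrixRotation]
  generalize Real.cos r = c
  generalize Real.sin r = s
  ext i j
  fin_cases i <;> fin_cases j <;>
    simp [gen01, su01] <;>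
    linear_combination (c - 1) * h

theorem matrixRotation_gen02 {u : ℂ} (hu : ‖u‖ = 1) (r : ℝ) :
    matrixRotation (gen02 u) r = su02 (Real.cos r : ℝ) (Real.sin r * u) := by
  have h := star_mul_self_of_norm_eq_one hu
  simp only [Complex.star_def] at h
  simp only [matrixRotation]
  generalize Real.cos r = c
  generalize Real.sin r = s
  ext i j
  fin_cases i <;> fin_cases j <;>
    simp [gen02, su02] <;>
    linear_combination (c - 1) * h

theorem matrixRotation_gen12 {u : ℂ} (hu : ‖u‖ = 1) (r : ℝ) :
    matrixRotation (gen12 u) r = su12 (Real.cos r : ℝ) (Real.sin r * u) := by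
  have h := star_mul_self_of_norm_eq_one hu
  simp only [Complex.star_def] at h
  simp only [matrixRotation]
  generalize Real.cos r = c
  generalize Real.sin r = s
  ext i j
  fin_cases i <;> fin_cases j <;>
    simp [gen12, su12] <;>
    linear_combination (c - 1) * h

/-- The angle is arccos c, at most π; the weaker bound 4π is the one required for closing the loop.
-/
theorem exists_angle {c : ℝ} {s : ℂ} (h : (c : ℂ) * c + star s * s = 1) :
    ∃ (r : ℝ) (u : ℂ), |r| ≤ 4 * Real.pi ∧ ‖u‖ = 1 ∧ Real.cos r = c ∧ Real.sin r * u = s := by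
  have h' : c * c + ‖s‖ ^ 2 = 1 := by
    rw [star_mul_self_eq] at h
    exact_mod_cast h
  have hcos : Real.cos (Real.arccos c) = c := Real.cos_arccos (by nlinarith [sq_nonneg ‖s‖])
    (by nlinarith [sq_nonneg ‖s‖])
  have hsin : Real.sin (Real.arccos c) = ‖s‖ := by
    rw [Real.sin_arccos, show 1 - c ^ 2 = ‖s‖ ^ 2 by linarith, Real.sqrt_sq (norm_nonneg s)]
  refine ⟨Real.arccos c, Complex.exp (Complex.arg s * Complex.I), ?_,
    Complex.norm_exp_ofReal_mul_I _, hcos, ?_⟩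
  · rw [abs_of_nonneg (Real.arccos_nonneg c)]
    linarith [Real.arccos_le_pi c, Real.pi_pos]
  · rw [hsin, Complex.norm_mul_exp_arg_mul_I]

namespace UnimodularFrame

variable {E : Type*} [NormedAddCommGroup E] [NormedSpace ℂ E] (S : UnimodularFrame E)

theorem isLeftInvariantCoframe [Group E]
    (h : ∀ a x v, S.θ (a * x) (fderiv ℂ (fun y => a * y) x v) = S.θ x v) :
    IsLeftInvariantCoframe S.coframe where
  holomorphic := S.differentiable_coframe
  left_invariant i a x v := congrFun (h a x v) i
  bijective x := (S.θ x).bijective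

/-- If complex lines spanned by the `k`-th frame field act by rotations of a coordinate plane, then
the corresponding `SU(2)` is contained in the holonomy group. -/
theorem isTransportMatrix_of_isStraight {k : Fin 3} (hk : S.IsStraight k)
    {gen : ℂ → Matrix (Fin 3) (Fin 3) ℂ} {T : ℂ → ℂ → Matrix (Fin 3) (Fin 3) ℂ}
    (hgen : ∀ u, ‖u‖ = 1 → gen u * gen u * gen u = - gen u)
    (hb : ∀ (r : ℝ) (u : ℂ), S.bismutMatrix (Pi.single k (r * u)) = -(r • gen u))
    (hrot : ∀ u, ‖u‖ = 1 → ∀ r : ℝ, matrixRotation (gen u) r = T (Real.cos r : ℝ) (Real.sin r * u))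
    (hT : ∀ a b c d, T a b * T c d = T (a * c - star b * d) (b * c + star a * d))
    (x : E) {a b : ℂ} (hab : star a * a + star b * b = 1) : S.IsTransportMatrix x x (T a b) := by
  -- The identity arises as the rotation by 2π.
  have h1 : S.IsTransportMatrix x x 1 := by
    have := S.isTransportMatrix_rotation hk hgen hb x (r := 2 * Real.pi) (u := 1)
      (by rw [abs_of_pos Real.two_pi_pos]; linarith [Real.pi_pos]) (by simp)
    rwa [matrixRotation_two_pi] at this
  refine mem_of_real_diagonal (S.holonomyMatrices x h1) T hT (fun c s hcs => ?_) hab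
  obtain ⟨r, u, hr, hu, rfl, rfl⟩ := exists_angle hcs
  rw [← hrot u hu]
  exact S.isTransportMatrix_rotation hk hgen hb x hr hu

/-- Reduces the derivative of a coframe to one-variable derivatives of its entries along a complex
line. -/
theorem fderiv_apply_of_hasDerivAt {F : E → E →L[ℂ] (Fin 3 → ℂ)} (hF : Differentiable ℂ F)
    {x u v : E} {w : Fin 3 → ℂ} (h : ∀ i, HasDerivAt (fun t : ℂ => F (x + t • u) v i) (w i) 0) :
    fderiv ℂ F x u v = w := by
  have hl : HasDerivAt (fun t : ℂ => x + t • u) u 0 :=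
    (((hasDerivAt_id (0 : ℂ)).smul_const u).const_add x).congr_deriv (one_smul ℂ u)
  have hF' : HasFDerivAt F (fderiv ℂ F x) (x + (0 : ℂ) • u) := by
    simpa using (hF x).hasFDerivAt
  have h1 : HasDerivAt (fun t : ℂ => F (x + t • u)) (fderiv ℂ F x u) 0 := hF'.comp_hasDerivAt 0 hl
  have h2 : HasDerivAt (fun t : ℂ => F (x + t • u) v) (fderiv ℂ F x u v) 0 := by
    simpa using h1.clm_apply (hasDerivAt_const (0 : ℂ) v)
  exact h2.unique (hasDerivAt_pi.2 h)

end UnimodularFrame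

open UnimodularFrame

/-! ### The complex Heisenberg group -/

namespace IwasawaGroup

instance : FiniteDimensional ℂ IwasawaGroup := inferInstanceAs (FiniteDimensional ℂ (Fin 3 → ℂ))

/-- The coordinates of a tangent vector with respect to the left-invariant frame. -/
def frameEquiv (x : IwasawaGroup) : IwasawaGroup ≃L[ℂ] (Fin 3 → ℂ) :=
  LinearEquiv.toContinuousLinearEquiv
    -- The third form is z₁dz₂ - dz₃ in the numbering 1, 2, 3, whose sign gives dφ³ = +φ¹²; it also
    -- makes the coordinate map its own inverse.
    { toFun := fun v => ![v 0, v 1, x 0 * v 1 - v 2]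
      invFun := fun ξ => (![ξ 0, ξ 1, x 0 * ξ 1 - ξ 2] : Fin 3 → ℂ)
      map_add' := fun v w => by
        ext i
        fin_cases i
        · rfl
        · rfl
        · change x 0 * (v 1 + w 1) - (v 2 + w 2) = (x 0 * v 1 - v 2) + (x 0 * w 1 - w 2)
          ring
      map_smul' := fun c v => by
        ext i
        fin_cases i
        · rfl
        · rfl
        · change x 0 * (c * v 1) - c * v 2 = c * (x 0 * v 1 - v 2)
          ring
      left_inv := fun v => by
        funext i
        fin_cases i
        · rfl
        · rfl
        · change x 0 * v 1 - (x 0 * v 1 - v 2) = v 2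
          ring
      right_inv := fun v => by
        funext i
        fin_cases i
        · rfl
        · rfl
        · change x 0 * v 1 - (x 0 * v 1 - v 2) = v 2
          ring }

theorem frameEquiv_apply (x v : IwasawaGroup) :
    frameEquiv x v = ![v 0, v 1, x 0 * v 1 - v 2] := rfl

theorem frameEquiv_symm_apply (x : IwasawaGroup) (ξ : Fin 3 → ℂ) :
    (frameEquiv x).symm ξ = (![ξ 0, ξ 1, x 0 * ξ 1 - ξ 2] : Fin 3 → ℂ) := rfl

theorem contDiff_coord (i : Fin 3) : ContDiff ℂ ∞ fun x : IwasawaGroup => x i :=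
  contDiff_apply ℂ ℂ i

theorem contDiff_frameEquiv :
    ContDiff ℂ ∞ fun x => (frameEquiv x : IwasawaGroup →L[ℂ] (Fin 3 → ℂ)) := by
  refine contDiff_clm_apply_iff.2 fun v => contDiff_pi.2 fun i => ?_
  fin_cases i
  · exact contDiff_const
  · exact contDiff_const
  · exact ((contDiff_coord 0).mul contDiff_const).sub contDiff_const

theorem fderiv_frameEquiv (x u v : IwasawaGroup) :
    fderiv ℂ (fun x => (frameEquiv x : IwasawaGroup →L[ℂ] (Fin 3 → ℂ))) x u v
      = ![0, 0, u 0 * v 1] := by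
  refine fderiv_apply_of_hasDerivAt (contDiff_frameEquiv.differentiable (by simp)) fun i => ?_
  fin_cases i
  · exact hasDerivAt_const _ _
  · exact hasDerivAt_const _ _
  · change HasDerivAt (fun t : ℂ => (x 0 + t * u 0) * v 1 - v 2) (u 0 * v 1) 0
    simpa using ((((hasDerivAt_id (0 : ℂ)).mul_const (u 0)).const_add (x 0)).mul_const
      (v 1)).sub_const (v 2)

/-- The left-invariant frame. -/
def frame : UnimodularFrame IwasawaGroup where
  θ := frameEquiv
  ad :=
    { toFun := fun ξ => !![0, 0, 0; 0, 0, 0; ξ 1, -ξ 0, 0]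
      map_add' := fun ξ η => by
        ext i j; fin_cases i <;> fin_cases j <;> simp; ring
      map_smul' := fun c ξ => by
        ext i j; fin_cases i <;> fin_cases j <;> simp }
  contDiff := contDiff_frameEquiv
  maurerCartan x u v := by
    rw [fderiv_frameEquiv, fderiv_frameEquiv, frameEquiv_apply, frameEquiv_apply]
    ext i
    fin_cases i <;> simp
    ring
  ad_skew ξ η := by
    ext i
    fin_cases i <;> simp [Matrix.mulVec, dotProduct, Fin.sum_univ_three]
    ring
  trace_ad ξ := by simp [Matrix.trace_fin_three]

theorem frame_θ (x : IwasawaGroup) : frame.θ x = frameEquiv x := rfl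

theorem frame_ad (ξ : Fin 3 → ℂ) : frame.ad ξ = !![0, 0, 0; 0, 0, 0; ξ 1, -ξ 0, 0] := rfl

theorem frame_left_invariant (a x v : IwasawaGroup) :
    frame.θ (a * x) (fderiv ℂ (fun y => a * y) x v) = frame.θ x v := by
  have hd : HasFDerivAt (fun y : IwasawaGroup => a * y) (fderiv ℂ (fun y => a * y) x)
      (x + (0 : ℂ) • v) := by
    rw [zero_smul, add_zero]
    refine (ContDiff.differentiable (n := ∞) ?_ (by simp) x).hasFDerivAt
    refine contDiff_pi (E := IwasawaGroup) (F' := fun _ : Fin 3 => ℂ) |>.2 fun i => ?_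
    fin_cases i
    · exact contDiff_const.add (contDiff_coord 0)
    · exact contDiff_const.add (contDiff_coord 1)
    · exact (contDiff_const.add (contDiff_coord 2)).add (contDiff_const.mul (contDiff_coord 1))
  have h1 := hd.comp_hasDerivAt (0 : ℂ) (((hasDerivAt_id (0 : ℂ)).smul_const v).const_add x)
  have h2 : HasDerivAt (fun t : ℂ => a * (x + t • v))
      ((![v 0, v 1, v 2 + a 0 * v 1] : Fin 3 → ℂ) : IwasawaGroup) 0 := by
    refine (hasDerivAt_pi (E' := fun _ : Fin 3 => ℂ)).2 fun i => ?_
    have hl (i : Fin 3) : HasDerivAt (fun t : ℂ => x i + t * v i) (v i) 0 := by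
      simpa using ((hasDerivAt_id (0 : ℂ)).mul_const (v i)).const_add (x i)
    fin_cases i
    · exact (hl 0).const_add (a 0)
    · exact (hl 1).const_add (a 1)
    · exact ((hl 2).const_add (a 2)).add ((hl 1).const_mul (a 0))
  have h3 := h1.unique h2
  rw [one_smul] at h3
  rw [h3]
  ext i
  fin_cases i
  · rfl
  · rfl
  · change (a 0 + x 0) * v 1 - (v 2 + a 0 * v 1) = x 0 * v 1 - v 2
    ring

theorem structureEquations : StructureEquationsI frame.coframe := by
  intro x u v
  simp only [extDeriv_coframe, wedge, coframe_apply, frame_ad]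
  refine ⟨?_, ?_, ?_⟩ <;> simp [dotProduct, Fin.sum_univ_three]
  ring

theorem isBalanced : frame.metric.IsBalanced := by
  refine frame.isBalanced_of_sum_eq_zero fun a b c d e => ?_
  simp [frame_ad, kahlerPair, stdInner_apply, dotProduct, Fin.sum_univ_three]
  ring

theorem isStraight_zero : frame.IsStraight 0 := fun x a b => by
  simp only [frame_θ, frameEquiv_symm_apply]
  simp
  rfl

/-- The field (0, 1, x₀) depends only on the coordinate 0, which is constant along its own lines. -/
theorem isStraight_one : frame.IsStraight 1 := fun x a b => by
  have h : (x + (frameEquiv x).symm (Pi.single 1 a)) 0 = x 0 := add_zero (x 0)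
  rw [frame_θ, frame_θ, frameEquiv_symm_apply, h, frameEquiv_symm_apply]

theorem holonomyGroup_eq (p : IwasawaGroup) :
    holonomyGroup frame.bismut p = specialUnitary frame.coframe p := by
  refine (frame.holonomyGroup_subset p).antisymm
    (frame.specialUnitary_subset_holonomyGroup fun U hU => ?_)
  have h12 (a b : ℂ) (hab : star a * a + star b * b = 1) :
      frame.IsTransportMatrix p p (su12 a b) :=
    frame.isTransportMatrix_of_isStraight isStraight_zero (fun u => gen12_cube)
      (fun r u => by
        ext i j
        fin_cases i <;> fin_cases j <;> simp [bismutMatrix, frame_ad, gen12])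
      (fun u hu r => matrixRotation_gen12 hu r) su12_mul p hab
  have h02 (a b : ℂ) (hab : star a * a + star b * b = 1) :
      frame.IsTransportMatrix p p (su02 a b) := by
    -- The entry of ad in position (2,0) is +ξ₁, opposite to the sign convention of `gen02`; hence
    -- -u, and b replaced by -b.
    have := frame.isTransportMatrix_of_isStraight (gen := fun u => gen02 (-u))
      (T := fun a b => su02 a (-b)) isStraight_one (fun u hu => gen02_cube (by simpa using hu))
      (fun r u => by
        ext i j
        fin_cases i <;> fin_cases j <;> simp [bismutMatrix, frame_ad, gen02])
      (fun u hu r => by rw [matrixRotation_gen02 (by simpa using hu)]; simp)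
      (fun a b c d => by rw [su02_mul]; congr 1 <;> simp; ring) p (a := a) (b := -b)
      (by simpa using hab)
    simpa using this
  have h1 : frame.IsTransportMatrix p p 1 := su02_one_zero ▸ h02 1 0 (by simp)
  exact specialUnitaryGroup_subset_of_su12_su02 (frame.holonomyMatrices p h1) h12 h02 hU

end IwasawaGroup

/-! ### The semidirect product -/

namespace SolvGroup

instance : FiniteDimensional ℂ SolvGroup := inferInstanceAs (FiniteDimensional ℂ (Fin 3 → ℂ))

/-- The coordinates of a tangent vector with respect to the left-invariant frame. -/
def frameEquiv (x : SolvGroup) : SolvGroup ≃L[ℂ] (Fin 3 → ℂ) :=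
  LinearEquiv.toContinuousLinearEquiv
    -- The exponential factors undo the scalings by exp(∓a₀) that left translation by a induces on
    -- the last two coordinates.
    { toFun := fun v => ![v 0, Complex.exp (x 0) * v 1, Complex.exp (-x 0) * v 2]
      invFun := fun ξ => (![ξ 0, Complex.exp (-x 0) * ξ 1, Complex.exp (x 0) * ξ 2] : Fin 3 → ℂ)
      map_add' := fun v w => by
        ext i
        fin_cases i
        · rfl
        · exact mul_add _ (v 1) (w 1)
        · exact mul_add _ (v 2) (w 2)
      map_smul' := fun c v => by
        ext i
        fin_cases i
        · rfl
        · exact mul_left_comm _ c (v 1)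
        · exact mul_left_comm _ c (v 2)
      left_inv := fun v => by
        funext i
        fin_cases i
        · rfl
        · change Complex.exp (-x 0) * (Complex.exp (x 0) * v 1) = v 1
          rw [← mul_assoc, ← Complex.exp_add]; simp
        · change Complex.exp (x 0) * (Complex.exp (-x 0) * v 2) = v 2
          rw [← mul_assoc, ← Complex.exp_add]; simp
      right_inv := fun v => by
        funext i
        fin_cases i
        · rfl
        · change Complex.exp (x 0) * (Complex.exp (-x 0) * v 1) = v 1
          rw [← mul_assoc, ← Complex.exp_add]; simp
        · change Complex.exp (-x 0) * (Complex.exp (x 0) * v 2) = v 2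
          rw [← mul_assoc, ← Complex.exp_add]; simp }

theorem frameEquiv_apply (x v : SolvGroup) :
    frameEquiv x v = ![v 0, Complex.exp (x 0) * v 1, Complex.exp (-x 0) * v 2] := rfl

theorem frameEquiv_symm_apply (x : SolvGroup) (ξ : Fin 3 → ℂ) :
    (frameEquiv x).symm ξ = (![ξ 0, Complex.exp (-x 0) * ξ 1, Complex.exp (x 0) * ξ 2] : Fin 3 → ℂ) := rfl

theorem contDiff_coord (i : Fin 3) : ContDiff ℂ ∞ fun x : SolvGroup => x i :=
  contDiff_apply ℂ ℂ i

theorem contDiff_frameEquiv :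
    ContDiff ℂ ∞ fun x => (frameEquiv x : SolvGroup →L[ℂ] (Fin 3 → ℂ)) := by
  refine contDiff_clm_apply_iff.2 fun v => contDiff_pi.2 fun i => ?_
  fin_cases i
  · exact contDiff_const
  · exact (Complex.contDiff_exp.comp (contDiff_coord 0)).mul contDiff_const
  · exact (Complex.contDiff_exp.comp (contDiff_coord 0).neg).mul contDiff_const

theorem fderiv_frameEquiv (x u v : SolvGroup) :
    fderiv ℂ (fun x => (frameEquiv x : SolvGroup →L[ℂ] (Fin 3 → ℂ))) x u v
      = ![0, Complex.exp (x 0) * u 0 * v 1, -(Complex.exp (-x 0) * u 0 * v 2)] := by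
  refine fderiv_apply_of_hasDerivAt (contDiff_frameEquiv.differentiable (by simp)) fun i => ?_
  have hl : HasDerivAt (fun t : ℂ => x 0 + t * u 0) (u 0) 0 := by
    simpa using ((hasDerivAt_id (0 : ℂ)).mul_const (u 0)).const_add (x 0)
  fin_cases i
  · exact hasDerivAt_const _ _
  · change HasDerivAt (fun t : ℂ => Complex.exp (x 0 + t * u 0) * v 1) _ 0
    simpa using hl.cexp.mul_const (v 1)
  · change HasDerivAt (fun t : ℂ => Complex.exp (-(x 0 + t * u 0)) * v 2) _ 0
    simpa using hl.neg.cexp.mul_const (v 2)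

/-- The left-invariant frame. -/
def frame : UnimodularFrame SolvGroup where
  θ := frameEquiv
  ad :=
    { toFun := fun ξ => !![0, 0, 0; ξ 1, -ξ 0, 0; -ξ 2, 0, ξ 0]
      map_add' := fun ξ η => by
        ext i j; fin_cases i <;> fin_cases j <;> simp <;> ring
      map_smul' := fun c ξ => by
        ext i j; fin_cases i <;> fin_cases j <;> simp }
  contDiff := contDiff_frameEquiv
  maurerCartan x u v := by
    rw [fderiv_frameEquiv, fderiv_frameEquiv, frameEquiv_apply, frameEquiv_apply]
    ext i
    fin_cases i <;> simp <;> ring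
  ad_skew ξ η := by
    ext i
    fin_cases i <;> simp [Matrix.mulVec, dotProduct, Fin.sum_univ_three] <;> ring
  trace_ad ξ := by simp [Matrix.trace_fin_three]

theorem frame_θ (x : SolvGroup) : frame.θ x = frameEquiv x := rfl

theorem frame_ad (ξ : Fin 3 → ℂ) : frame.ad ξ = !![0, 0, 0; ξ 1, -ξ 0, 0; -ξ 2, 0, ξ 0] := rfl

theorem frame_left_invariant (a x v : SolvGroup) :
    frame.θ (a * x) (fderiv ℂ (fun y => a * y) x v) = frame.θ x v := by
  have hd : HasFDerivAt (fun y : SolvGroup => a * y) (fderiv ℂ (fun y => a * y) x)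
      (x + (0 : ℂ) • v) := by
    rw [zero_smul, add_zero]
    refine (ContDiff.differentiable (n := ∞) ?_ (by simp) x).hasFDerivAt
    refine contDiff_pi (E := SolvGroup) (F' := fun _ : Fin 3 => ℂ) |>.2 fun i => ?_
    fin_cases i
    · exact contDiff_const.add (contDiff_coord 0)
    · exact contDiff_const.add (contDiff_const.mul (contDiff_coord 1))
    · exact contDiff_const.add (contDiff_const.mul (contDiff_coord 2))
  have h1 := hd.comp_hasDerivAt (0 : ℂ) (((hasDerivAt_id (0 : ℂ)).smul_const v).const_add x)
  have h2 : HasDerivAt (fun t : ℂ => a * (x + t • v))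
      ((![v 0, Complex.exp (-a 0) * v 1, Complex.exp (a 0) * v 2] : Fin 3 → ℂ) : SolvGroup) 0 := by
    refine (hasDerivAt_pi (E' := fun _ : Fin 3 => ℂ)).2 fun i => ?_
    have hl (i : Fin 3) : HasDerivAt (fun t : ℂ => x i + t * v i) (v i) 0 := by
      simpa using ((hasDerivAt_id (0 : ℂ)).mul_const (v i)).const_add (x i)
    fin_cases i
    · exact (hl 0).const_add (a 0)
    · exact ((hl 1).const_mul (Complex.exp (-a 0))).const_add (a 1)
    · exact ((hl 2).const_mul (Complex.exp (a 0))).const_add (a 2)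
  have h3 := h1.unique h2
  rw [one_smul] at h3
  rw [h3]
  ext i
  fin_cases i
  · rfl
  · change Complex.exp (a 0 + x 0) * (Complex.exp (-a 0) * v 1) = Complex.exp (x 0) * v 1
    rw [← mul_assoc, ← Complex.exp_add]; simp
  · change Complex.exp (-(a 0 + x 0)) * (Complex.exp (a 0) * v 2) = Complex.exp (-x 0) * v 2
    rw [← mul_assoc, ← Complex.exp_add]; simp

theorem structureEquations : StructureEquationsII frame.coframe := by
  intro x u v
  simp only [extDeriv_coframe, wedge, coframe_apply, frame_ad]
  refine ⟨?_, ?_, ?_⟩ <;> simp [dotProduct, Fin.sum_univ_three] <;> ring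

theorem isBalanced : frame.metric.IsBalanced := by
  refine frame.isBalanced_of_sum_eq_zero fun a b c d e => ?_
  simp [frame_ad, kahlerPair, stdInner_apply, dotProduct, Fin.sum_univ_three]
  ring

/-- The frame depends only on the coordinate 0, and the last two fields do not move it. -/
theorem isStraight_one : frame.IsStraight 1 := fun x a b => by
  have h : (x + (frameEquiv x).symm (Pi.single 1 a)) 0 = x 0 := add_zero (x 0)
  rw [frame_θ, frame_θ, frameEquiv_symm_apply, h, frameEquiv_symm_apply]

theorem isStraight_two : frame.IsStraight 2 := fun x a b => by
  have h : (x + (frameEquiv x).symm (Pi.single 2 a)) 0 = x 0 := add_zero (x 0)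
  rw [frame_θ, frame_θ, frameEquiv_symm_apply, h, frameEquiv_symm_apply]

theorem holonomyGroup_eq (p : SolvGroup) :
    holonomyGroup frame.bismut p = specialUnitary frame.coframe p := by
  refine (frame.holonomyGroup_subset p).antisymm
    (frame.specialUnitary_subset_holonomyGroup fun U hU => ?_)
  have h01 (a b : ℂ) (hab : star a * a + star b * b = 1) :
      frame.IsTransportMatrix p p (su01 a b) := by
    -- The entry of ad in position (1,0) is +ξ₁, which again forces the sign change in u and b.
    have := frame.isTransportMatrix_of_isStraight (gen := fun u => gen01 (-u))
      (T := fun a b => su01 a (-b)) isStraight_one (fun u hu => gen01_cube (by simpa using hu))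
      (fun r u => by
        ext i j
        fin_cases i <;> fin_cases j <;> simp [bismutMatrix, frame_ad, gen01])
      (fun u hu r => by rw [matrixRotation_gen01 (by simpa using hu)]; simp)
      (fun a b c d => by rw [su01_mul]; congr 1 <;> simp; ring) p (a := a) (b := -b)
      (by simpa using hab)
    simpa using this
  have h02 (a b : ℂ) (hab : star a * a + star b * b = 1) :
      frame.IsTransportMatrix p p (su02 a b) :=
    frame.isTransportMatrix_of_isStraight isStraight_two (fun u => gen02_cube)
      (fun r u => by
        ext i j
        fin_cases i <;> fin_cases j <;> simp [bismutMatrix, frame_ad, gen02])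
      (fun u hu r => matrixRotation_gen02 hu r) su02_mul p hab
  have h1 : frame.IsTransportMatrix p p 1 := su02_one_zero ▸ h02 1 0 (by simp)
  exact specialUnitaryGroup_subset_of_su01_su02 (frame.holonomyMatrices p h1) h01 h02 hU

end SolvGroup

end BismutHolonomy

end

open BismutHolonomy in
theorem theorem4p1 :
    (∃ φ : Fin 3 → IwasawaGroup → IwasawaGroup →L[ℂ] ℂ,
      IsLeftInvariantCoframe φ ∧ StructureEquationsI φ ∧
      ∃ g : HermitianMetric IwasawaGroup, IsUnitaryCoframe g φ ∧ g.IsBalanced ∧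
        ∃ Γ : Connection IwasawaGroup, IsBismut g Γ ∧
          ∀ p, holonomyGroup Γ p = specialUnitary φ p) ∧
    (∃ φ : Fin 3 → SolvGroup → SolvGroup →L[ℂ] ℂ,
      IsLeftInvariantCoframe φ ∧ StructureEquationsII φ ∧
      ∃ g : HermitianMetric SolvGroup, IsUnitaryCoframe g φ ∧ g.IsBalanced ∧
        ∃ Γ : Connection SolvGroup, IsBismut g Γ ∧
          ∀ p, holonomyGroup Γ p = specialUnitary φ p) := by
  refine ⟨⟨IwasawaGroup.frame.coframe,
      IwasawaGroup.frame.isLeftInvariantCoframe IwasawaGroup.frame_left_invariant,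
      IwasawaGroup.structureEquations, IwasawaGroup.frame.metric,
      IwasawaGroup.frame.isUnitaryCoframe, IwasawaGroup.isBalanced,
      IwasawaGroup.frame.bismut, IwasawaGroup.frame.isBismut, IwasawaGroup.holonomyGroup_eq⟩,
    ⟨SolvGroup.frame.coframe,
      SolvGroup.frame.isLeftInvariantCoframe SolvGroup.frame_left_invariant,
      SolvGroup.structureEquations, SolvGroup.frame.metric,
      SolvGroup.frame.isUnitaryCoframe, SolvGroup.isBalanced,
      SolvGroup.frame.bismut, SolvGroup.frame.isBismut, SolvGroup.holonomyGroup_eq⟩⟩
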